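/- Let $\mathcal A$ be a finite set and let $a_k\in\mathcal A$, $n_k\ge 2$ and $0\le r_k<n_k$ ($k\ge 0$) be sequences such that $a_k\ne a_{k+1}$ for all $k$ and at least two letters occur infinitely often in $(a_k)$. Let $\omega\in\mathcal A^{\mathbb Z}$ be a simple Toeplitz word with coding $(a_k),(n_k),(r_k)$: start with a word that consists only of holes, and for $k=0,1,2,\dots$ fill the periodic word $(a_k^{n_k-1}?)^\infty$, which has its holes at $n_k\mathbb Z+r_k$, into the remaining holes (its letter at position $0$ goes into the first hole at a non-negative position); if a position is never filled, put a letter there that occurs infinitely often in $(a_k)$; the resulting word $\omega$ is required to be non-periodic. Let $X$ be the closure of $\{T^k\omega : k\in\mathbb N\}$, where $T$ is the left shift, and let $\mathcal L(X)$ be the set of finite words occurring in elements of $X$. For $L\ge 1$, the $L$-th de Bruijn (Rauzy) graph $G_L$ of $X$ has as vertices the words of length $L$ in $\mathcal L(X)$, with an edge $u\to v$ if $u(2)\cdots u(L)=v(1)\cdots v(L-1)$ and $u\,v(L)=u(1)\,v\in\mathcal L(X)$. Put $\mathcal A_k=\{a_j: j\ge k\}$, let $p^{(-1)}$ be the empty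 word and $p^{(k)}=p^{(k-1)}a_kp^{(k-1)}\cdots a_kp^{(k-1)}$ with $n_k$ copies of $p^{(k-1)}$. "An arc for the letter $b$ from $u$ to $v$" means a directed path from $u$ to $v$ whose second vertex is $u(2)\cdots u(L)\,b$. In the descriptions below, different paths and arcs share no edges, and no vertices except end points; a path with $0$ edges means that its two ends coincide. **Figure 1.** Let $1\le L\le |p^{(0)}|=n_0-1$, and let $v_1=a_0^L$. Then $G_L$ consists of one arc with $L+1$ edges from $v_1$ to $v_1$ for each letter $b\in\mathcal A_0\setminus\{a_0\}$ and, if $L<|p^{(0)}|$ or $a_0\in\mathcal A_1$, a loop with one edge at $v_1$ for the letter $a_0$. The reflection fixes $v_1$ and reverses every arc. Now let $k\ge 1$ and $|p^{(k-1)}|+1\le L\le |p^{(k)}|$. Let $u_1$ and $v_1$ be the prefix and the suffix of length $L$ of $p^{(k)}$, let $r = L \bmod (|p^{(k-1)}|+1)$ and $\tilde r= L\bmod (|p^{(k-2)}|+1)$. **Figure 2.** If $a_{k-1}\notin\mathcal A_k$ or $L>2|p^{(k-1)}|-|p^{(k-2)}|$, then $G_L$ consists of a path with $|p^{(k-1)}|-r$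 edges from $u_1$ to $v_1$; for each letter $b\in\mathcal A_k\setminus\{a_k\}$ an arc with $L+1$ edges from $v_1$ to $u_1$; and, if $L<|p^{(k)}|-|p^{(k-1)}|$ or $a_k\in\mathcal A_{k+1}$, an arc with $r+1$ edges from $v_1$ to $u_1$ for the letter $a_k$. The reflection exchanges $u_1$ and $v_1$ and reverses every path and every arc. **Figure 3.** If $a_{k-1}\in\mathcal A_k$ and $L\le 2|p^{(k-1)}|-|p^{(k-2)}|$, let $u_2$ and $v_2$ be the prefix and the suffix of length $L$ of $p^{(k-1)}a_{k-1}p^{(k-1)}$. Then $G_L$ consists of a path with $|p^{(k-1)}|-r$ edges from $u_1$ to $v_1$; for each letter $b\in\mathcal A_k\setminus\{a_{k-1},a_k\}$ an arc with $L+1$ edges from $v_1$ to $u_1$; if $L<|p^{(k)}|-|p^{(k-1)}|$ or $a_k\in\mathcal A_{k+1}$, an arc with $r+1$ edges from $v_1$ to $u_1$ for the letter $a_k$; an arc with $r+1$ edges from $v_1$ to $u_2$ for the letter $a_{k-1}$; an arc with $r+1$ edges from $v_2$ to $u_1$ for the letter $a_k$; a path with $|p^{(k-2)}|-\tilde r$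 edges from $u_2$ to $v_2$; and an arc with $\tilde r+1$ edges from $v_2$ to $u_2$ for the letter $a_{k-1}$. The reflection exchanges $u_1$ with $v_1$ and $u_2$ with $v_2$; it exchanges the arc from $v_1$ to $u_2$ with the arc from $v_2$ to $u_1$, and it reverses every other path and arc. **Proposition.** For every $L\ge 1$, the graph $G_L$ is completely described by the figure that belongs to $L$ (every vertex and every edge of $G_L$ is drawn exactly once), and for every vertex $w$ the reversed word $w(L)\cdots w(1)$ is the vertex obtained from $w$ by the reflection of the figure (which maps the $j$-th vertex of an arc, counted from its beginning, to the $j$-th vertex of the reflected arc, counted from its end). Hence a vertex is a palindrome if and only if it lies on the reflection axis, that is, it is the node $v_1$ in Figure 1, or the midpoint of a path or arc that is mapped to itself by the reflection and has an even number of edges. -/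

import Mathlib

namespace ToeplitzRauzy

universe u

section Words

variable {A : Type u}

/-- A finite word `w` occurs in the two-sided infinite word `ρ`. The empty word always does. -/
def OccursIn (w : List A) (ρ : ℤ → A) : Prop :=
  ∃ j : ℤ, ∀ (i : ℕ) (hi : i < w.length), w[i] = ρ (j + i)

/-- The language of a set of two-sided infinite words. -/
def language (X : Set (ℤ → A)) : Set (List A) :=
  {w | ∃ ρ ∈ X, OccursIn w ρ}

/-- The left shift. -/
def shift (ρ : ℤ → A) : ℤ → A := fun j => ρ (j + 1)

/-- The subshift associated with `ω`: the closure of the forward orbit of `ω`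
in the product topology. -/
def subshiftOf [TopologicalSpace A] (ω : ℤ → A) : Set (ℤ → A) :=
  closure {ρ | ∃ k : ℕ, 1 ≤ k ∧ ρ = shift^[k] ω}

/-- Vertices of the `L`-th de Bruijn (Rauzy) graph: the words of length `L` in the language. -/
abbrev DeBruijnVertex (X : Set (ℤ → A)) (L : ℕ) : Type u :=
  {w : List A // w ∈ language X ∧ w.length = L}

/-- The `L`-th de Bruijn graph (`1 ≤ L`): there is an edge from `x` to `y` if
`x(2) … x(L) = y(1) … y(L-1)` and `x y(L) = x(1) y` is in the language. -/
def deBruijn (X : Set (ℤ → A)) (L : ℕ) : Digraph (DeBruijnVertex X L) where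
  Adj x y := ∃ b c : A, x.1 ++ [b] = c :: y.1 ∧ x.1 ++ [b] ∈ language X

end Words

section Toeplitz

variable {A : Type u}

/-- The periodic word with holes `(c^{n-1}?)^∞`, with holes (`none`) at `n ℤ + r`. -/
def periodicWord (c : A) (n r : ℕ) : ℤ → Option A :=
  fun j => if (n : ℤ) ∣ j - r then none else some c

/-- Filling `β` into the holes of `α`, where the holes of `α` are at the positions `n ℤ + r`. -/
def fill (α : ℤ → Option A) (n r : ℕ) (β : ℤ → Option A) : ℤ → Option A :=
  fun j => if (n : ℤ) ∣ j - r then β ((j - r) / n) else α j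

/-- The distance `n₀ ⋯ n_{m-1}` of consecutive holes after `m` filling steps. -/
def holePeriod (n : ℕ → ℕ) (m : ℕ) : ℕ := ∏ i ∈ Finset.range m, n i

/-- The position of the first hole at a non-negative position after `m` filling steps. -/
def holeOffset (n r : ℕ → ℕ) (m : ℕ) : ℕ := ∑ j ∈ Finset.range m, r j * holePeriod n j

/-- The word with holes after `m` filling steps, i.e. the word
`(a₀^{n₀-1}?)^∞ ◁ ⋯ ◁ (a_{m-1}^{n_{m-1}-1}?)^∞`; for `m = 0` nothing is filled in yet. -/
def holeWord (a : ℕ → A) (n r : ℕ → ℕ) : ℕ → ℤ → Option A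
  | 0 => fun _ => none
  | m + 1 => fill (holeWord a n r m) (holePeriod n m) (holeOffset n r m)
      (periodicWord (a m) (n m) (r m))

/-- The holes after `m` steps are where `fill` presumes them. -/
theorem holeWord_eq_none_iff (a : ℕ → A) (n r : ℕ → ℕ) (hn : ∀ k, 2 ≤ n k) (m : ℕ) (j : ℤ) :
    holeWord a n r m j = none ↔ (holePeriod n m : ℤ) ∣ j - holeOffset n r m := by
  induction m generalizing j with
  | zero => simp [holeWord, holePeriod]
  | succ m ih =>
    have hpos : (holePeriod n m : ℤ) ≠ 0 := by
      have : 0 < holePeriod n m :=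
        Finset.prod_pos fun i _ => lt_of_lt_of_le (by norm_num) (hn i)
      exact_mod_cast this.ne'
    have hP : (holePeriod n (m + 1) : ℤ) = holePeriod n m * n m := by
      simp [holePeriod, Finset.prod_range_succ]
    have hR : (holeOffset n r (m + 1) : ℤ) = holeOffset n r m + r m * holePeriod n m := by
      simp [holeOffset, Finset.sum_range_succ]
    by_cases h : (holePeriod n m : ℤ) ∣ j - holeOffset n r m
    · obtain ⟨q, hq⟩ := h
      have h1 : j - (holeOffset n r (m + 1) : ℤ) = holePeriod n m * (q - r m) := by
        rw [hR]; linear_combination hq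
      have h2 : holeWord a n r (m + 1) j = periodicWord (a m) (n m) (r m) q := by
        simp only [holeWord, fill]
        rw [if_pos ⟨q, hq⟩, hq, Int.mul_ediv_cancel_left _ hpos]
      rw [h1, hP, mul_dvd_mul_iff_left hpos, h2, periodicWord]
      split_ifs <;> simp_all
    · have h2 : holeWord a n r (m + 1) j = holeWord a n r m j := by
        simp only [holeWord, fill]
        rw [if_neg h]
      rw [h2, ih]
      refine iff_of_false h fun h' => h ?_
      have h3 : (holePeriod n m : ℤ) ∣ j - holeOffset n r (m + 1) :=
        (Dvd.intro _ hP.symm).trans h'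
      have h4 : j - (holeOffset n r m : ℤ)
          = (j - holeOffset n r (m + 1)) + r m * holePeriod n m := by
        rw [hR]; ring
      rw [h4]
      exact dvd_add h3 (dvd_mul_left _ _)

/-- `tailAlphabet a k = {a_j : j ≥ k}`. -/
def tailAlphabet (a : ℕ → A) (k : ℕ) : Set A := {b | ∃ j, k ≤ j ∧ a j = b}

/-- The letters that occur infinitely often in `a`. -/
def eventualAlphabet (a : ℕ → A) : Set A := ⋂ k, tailAlphabet a k

/-- The standing assumptions on the coding sequences. -/
structure IsCoding (a : ℕ → A) (n r : ℕ → ℕ) : Prop where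
  two_le : ∀ k, 2 ≤ n k
  lt : ∀ k, r k < n k
  ne_succ : ∀ k, a k ≠ a (k + 1)
  eventual : (eventualAlphabet a).Nontrivial

/-- `ω` is a simple Toeplitz word with coding `(a, n, r)`: it is the limit of the words with holes,
where the position which stays undetermined forever (if there is one) is filled with
a letter of the eventual alphabet, and it is not periodic. -/
structure IsSimpleToeplitzWord (a : ℕ → A) (n r : ℕ → ℕ) (ω : ℤ → A) : Prop where
  determined : ∀ m j b, holeWord a n r m j = some b → ω j = b
  undetermined : ∃ b ∈ eventualAlphabet a, ∀ j, (∀ m, holeWord a n r m j = none) → ω j = b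
  not_periodic : ¬ ∃ p : ℤ, p ≠ 0 ∧ Function.Periodic ω p

/-- The block of letters between consecutive holes after `m` filling steps. So, in the usual
numbering, `block a n (k + 1)` is `p^{(k)}`, and `block a n 0` is the empty word `p^{(-1)}`.
The recursion reads `p^{(k)} = p^{(k-1)} a_k p^{(k-1)} ⋯ a_k p^{(k-1)}` with
`n_k` copies of `p^{(k-1)}`. -/
def block (a : ℕ → A) (n : ℕ → ℕ) : ℕ → List A
  | 0 => []
  | m + 1 => block a n m ++ (List.replicate (n m - 1) (a m :: block a n m)).flatten

end Toeplitz

section Diagrams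

/-- A mirror-symmetric drawing of a directed graph: nodes joined by directed arcs. The arc `i`
consists of `len i` consecutive edges, hence has `len i - 1` further vertices in its interior if
`len i ≥ 1`; if `len i = 0`, its two end nodes are the same vertex. Some arcs carry a letter.
The reflection in the vertical axis takes nodes to nodes and arcs to arcs. It exchanges the left and
the right end of an arc, that is, its source and its target. -/
structure ArcDiagram (A : Type u) where
  Node : Type
  Arc : Type u
  src : Arc → Node
  tgt : Arc → Node
  len : Arc → ℕ
  label : Arc → Option A
  mirrorNode : Node → Node
  mirrorArc : Arc → Arc
  mirrorNode_mirrorNode : ∀ v, mirrorNode (mirrorNode v) = v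
  mirrorArc_mirrorArc : ∀ i, mirrorArc (mirrorArc i) = i
  len_mirrorArc : ∀ i, len (mirrorArc i) = len i
  src_mirrorArc : ∀ i, src (mirrorArc i) = mirrorNode (tgt i)
  tgt_mirrorArc : ∀ i, tgt (mirrorArc i) = mirrorNode (src i)

namespace ArcDiagram

variable {A : Type u} (D : ArcDiagram A)

/-- The end points of each arc are glued to its end nodes. -/
inductive Glue : D.Node ⊕ (Σ i : D.Arc, Fin (D.len i + 1)) →
    D.Node ⊕ (Σ i : D.Arc, Fin (D.len i + 1)) → Prop
  | src (i : D.Arc) : Glue (Sum.inr ⟨i, 0⟩) (Sum.inl (D.src i))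
  | tgt (i : D.Arc) : Glue (Sum.inr ⟨i, Fin.last _⟩) (Sum.inl (D.tgt i))

/-- The vertices of the drawn graph. -/
def Vertex : Type u := Quot D.Glue

/-- A node as a vertex. -/
def node (v : D.Node) : D.Vertex := Quot.mk _ (Sum.inl v)

/-- The `j`-th vertex on the arc `i`, where `j = 0` is the source and `j = len i` the target. -/
def point (i : D.Arc) (j : Fin (D.len i + 1)) : D.Vertex := Quot.mk _ (Sum.inr ⟨i, j⟩)

/-- The edges of the drawn graph: the `len i` segments of each arc `i`. -/
abbrev Edge : Type u := Σ i : D.Arc, Fin (D.len i)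

/-- The vertex at which an edge starts. -/
def edgeSrc (e : D.Edge) : D.Vertex := D.point e.1 e.2.castSucc

/-- The vertex at which an edge ends. -/
def edgeTgt (e : D.Edge) : D.Vertex := D.point e.1 e.2.succ

/-- The reflection in the vertical axis, on vertices: it maps the `j`-th vertex of an arc to
the `j`-th vertex, counted from the other end, of the mirrored arc. -/
def reflect : D.Vertex → D.Vertex :=
  Quot.lift
    (Sum.elim (fun v => D.node (D.mirrorNode v))
      (fun p => D.point (D.mirrorArc p.1)
        (Fin.cast (by rw [D.len_mirrorArc]) (Fin.rev p.2))))
    (by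
      intro x y h
      cases h with
      | src i =>
        simp only [Sum.elim_inl, Sum.elim_inr]
        have h1 : D.point (D.mirrorArc i) (Fin.last _) = D.node (D.mirrorNode (D.src i)) := by
          rw [← D.tgt_mirrorArc]; exact Quot.sound (Glue.tgt _)
        rw [← h1]; congr 1; ext; simp [D.len_mirrorArc]
      | tgt i =>
        simp only [Sum.elim_inl, Sum.elim_inr]
        have h1 : D.point (D.mirrorArc i) 0 = D.node (D.mirrorNode (D.tgt i)) := by
          rw [← D.src_mirrorArc]; exact Quot.sound (Glue.src _)
        rw [← h1]; congr 1; ext; simp)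

/-- The reflection is an involution. -/
theorem reflect_reflect (x : D.Vertex) : D.reflect (D.reflect x) = x := by
  obtain ⟨x, rfl⟩ := Quot.exists_rep x
  rcases x with v | ⟨i, j⟩
  · exact congrArg D.node (D.mirrorNode_mirrorNode v)
  · have key : ∀ (i' : D.Arc) (h : i' = i) (j' : Fin (D.len i' + 1)), (j' : ℕ) = j →
        D.point i' j' = D.point i j := by
      rintro _ rfl j' hj
      exact congrArg _ (Fin.ext hj)
    refine key _ (D.mirrorArc_mirrorArc i) _ ?_
    have := j.2
    simp [Fin.val_rev, D.len_mirrorArc]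
    omega

/-- A vertex lies on the vertical axis if it is a node placed on the axis, or the midpoint of
an arc that the reflection maps to itself. -/
def OnAxis (x : D.Vertex) : Prop :=
  (∃ v, D.mirrorNode v = v ∧ x = D.node v) ∨
    ∃ (i : D.Arc) (j : Fin (D.len i + 1)),
      D.mirrorArc i = i ∧ 2 * (j : ℕ) = D.len i ∧ x = D.point i j

/-- The diagram `D` is a complete picture of the `L`-th de Bruijn graph of `X`, when each vertex
of the diagram is read as the word given by `φ`: vertices of the picture correspond bijectively to
vertices of the graph, and edges bijectively to edges; the nodes are the words `nodeWord`; and an arc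
with label `b` leaves its source by the extension with the letter `b` to the right. -/
structure Depicts (X : Set (ℤ → A)) (L : ℕ) (nodeWord : D.Node → List A)
    (φ : D.Vertex ≃ DeBruijnVertex X L) : Prop where
  adj : ∀ e : D.Edge, (deBruijn X L).Adj (φ (D.edgeSrc e)) (φ (D.edgeTgt e))
  existsUnique_edge : ∀ x y, (deBruijn X L).Adj x y →
    ∃! e : D.Edge, φ (D.edgeSrc e) = x ∧ φ (D.edgeTgt e) = y
  node : ∀ v, (φ (D.node v)).1 = nodeWord v
  label : ∀ e : D.Edge, (e.2 : ℕ) = 0 → ∀ b, D.label e.1 = some b →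
    (φ (D.edgeTgt e)).1 = (φ (D.edgeSrc e)).1.tail ++ [b]

/-- The diagram `D` depicts the `L`-th de Bruijn graph of `X` completely; in the picture,
reversal of words is reflection in the vertical axis, and the palindromes are precisely the vertices
on the axis. -/
def DepictsSymmetrically (X : Set (ℤ → A)) (L : ℕ) (nodeWord : D.Node → List A) : Prop :=
  ∃ φ : D.Vertex ≃ DeBruijnVertex X L,
    D.Depicts X L nodeWord φ ∧
    (∀ x, (φ (D.reflect x)).1 = (φ x).1.reverse) ∧
    (∀ x, (φ x).1.Palindrome ↔ D.OnAxis x)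

end ArcDiagram

/-- Arcs of the first figure: a loop, present only if `P` holds, and one arc per letter in `S`. -/
inductive Arc₁ {A : Type u} (S : Set A) (P : Prop) : Type u
  | loop (h : P)
  | arc (b : S)

/-- First figure, `1 ≤ L ≤ |p^{(0)}|`: a single node `v₁`, lying on the axis. For each letter
`b ∈ 𝒜₀ \ {a₀}` there is an arc with `L + 1` edges from `v₁` to `v₁`. Moreover, there is a loop
with one edge, labeled `a₀`, which for `L = |p^{(0)}| = n₀ - 1` exists only if `a₀ ∈ 𝒜₁`. -/
def figure₁ {A : Type u} (a : ℕ → A) (n : ℕ → ℕ) (L : ℕ) : ArcDiagram A where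
  Node := Unit
  Arc := Arc₁ (tailAlphabet a 0 \ {a 0}) (L < (block a n 1).length ∨ a 0 ∈ tailAlphabet a 1)
  src _ := ()
  tgt _ := ()
  len
    | .loop _ => 1
    | .arc _ => L + 1
  label
    | .loop _ => some (a 0)
    | .arc b => some b.1
  mirrorNode v := v
  mirrorArc i := i
  mirrorNode_mirrorNode _ := rfl
  mirrorArc_mirrorArc _ := rfl
  len_mirrorArc _ := rfl
  src_mirrorArc _ := rfl
  tgt_mirrorArc _ := rfl

/-- Nodes of the second figure. -/
inductive Node₂ : Type
  | u₁
  | v₁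

/-- The reflection on the nodes of the second figure. -/
def Node₂.mirror : Node₂ → Node₂
  | .u₁ => .v₁
  | .v₁ => .u₁

/-- Arcs of the second figure. The bottommost arc is present only if `P` holds. -/
inductive Arc₂ {A : Type u} (S : Set A) (P : Prop) : Type u
  | middle
  | bottom (h : P)
  | arc (b : S)

/-- Second figure, `k ≥ 1`, with `r = L mod (|p^{(k-1)}| + 1)`: a path with `|p^{(k-1)}| - r` edges
from `u₁` to `v₁`; from `v₁` to `u₁` one arc with `L + 1` edges for each letter
`b ∈ 𝒜ₖ \ {aₖ}`, and an arc with `r + 1` edges for the letter `aₖ`, which for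
`L ≥ |p^{(k)}| - |p^{(k-1)}|` exists only if `aₖ ∈ 𝒜ₖ₊₁`. -/
def figure₂ {A : Type u} (a : ℕ → A) (n : ℕ → ℕ) (k L : ℕ) : ArcDiagram A where
  Node := Node₂
  Arc := Arc₂ (tailAlphabet a k \ {a k})
    (L + (block a n k).length < (block a n (k + 1)).length ∨ a k ∈ tailAlphabet a (k + 1))
  src
    | .middle => .u₁
    | .bottom _ => .v₁
    | .arc _ => .v₁
  tgt
    | .middle => .v₁
    | .bottom _ => .u₁
    | .arc _ => .u₁
  len
    | .middle => (block a n k).length - L % ((block a n k).length + 1)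
    | .bottom _ => L % ((block a n k).length + 1) + 1
    | .arc _ => L + 1
  label
    | .middle => none
    | .bottom _ => some (a k)
    | .arc b => some b.1
  mirrorNode := Node₂.mirror
  mirrorArc i := i
  mirrorNode_mirrorNode v := by cases v <;> rfl
  mirrorArc_mirrorArc _ := rfl
  len_mirrorArc _ := rfl
  src_mirrorArc i := by cases i <;> rfl
  tgt_mirrorArc i := by cases i <;> rfl

/-- Nodes of the third figure. -/
inductive Node₃ : Type
  | u₁
  | v₁
  | u₂
  | v₂

/-- The reflection on the nodes of the third figure. -/
def Node₃.mirror : Node₃ → Node₃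
  | .u₁ => .v₁
  | .v₁ => .u₁
  | .u₂ => .v₂
  | .v₂ => .u₂

/-- Arcs of the third figure. The bottommost arc is present only if `P` holds. -/
inductive Arc₃ {A : Type u} (S : Set A) (P : Prop) : Type u
  | middle
  | bottom (h : P)
  | arc (b : S)
  | right
  | left
  | innerTop
  | innerBottom

/-- The reflection on the arcs of the third figure. -/
def Arc₃.mirror {A : Type u} {S : Set A} {P : Prop} : Arc₃ S P → Arc₃ S P
  | .right => .left
  | .left => .right
  | i => i

/-- Third figure, `k ≥ 1`, with `r = L mod (|p^{(k-1)}| + 1)` and `r' = L mod (|p^{(k-2)}| + 1)`: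
a path with `|p^{(k-1)}| - r` edges from `u₁` to `v₁`; from `v₁` to `u₁` one arc with `L + 1` edges
for each letter `b ∈ 𝒜ₖ \ {aₖ₋₁, aₖ}`, and an arc with `r + 1` edges for the letter `aₖ`, which for
`L ≥ |p^{(k)}| - |p^{(k-1)}|` exists only if `aₖ ∈ 𝒜ₖ₊₁`; an arc with `r + 1` edges from `v₁` to
`u₂` for the letter `aₖ₋₁` (on the right); a path with `|p^{(k-2)}| - r'` edges from `u₂` to `v₂`; an
arc with `r' + 1` edges from `v₂` to `u₂` for the letter `aₖ₋₁`; and an arc with `r + 1` edges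
from `v₂` to `u₁` for the letter `aₖ` (on the left). -/
def figure₃ {A : Type u} (a : ℕ → A) (n : ℕ → ℕ) (k L : ℕ) : ArcDiagram A where
  Node := Node₃
  Arc := Arc₃ (tailAlphabet a k \ {a (k - 1), a k})
    (L + (block a n k).length < (block a n (k + 1)).length ∨ a k ∈ tailAlphabet a (k + 1))
  src
    | .middle => .u₁
    | .bottom _ => .v₁
    | .arc _ => .v₁
    | .right => .v₁
    | .left => .v₂
    | .innerTop => .u₂
    | .innerBottom => .v₂
  tgt
    | .middle => .v₁
    | .bottom _ => .u₁
    | .arc _ => .u₁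
    | .right => .u₂
    | .left => .u₁
    | .innerTop => .v₂
    | .innerBottom => .u₂
  len
    | .middle => (block a n k).length - L % ((block a n k).length + 1)
    | .bottom _ => L % ((block a n k).length + 1) + 1
    | .arc _ => L + 1
    | .right => L % ((block a n k).length + 1) + 1
    | .left => L % ((block a n k).length + 1) + 1
    | .innerTop => (block a n (k - 1)).length - L % ((block a n (k - 1)).length + 1)
    | .innerBottom => L % ((block a n (k - 1)).length + 1) + 1
  label
    | .middle => none
    | .bottom _ => some (a k)
    | .arc b => some b.1
    | .right => some (a (k - 1))
    | .left => some (a k)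
    | .innerTop => none
    | .innerBottom => some (a (k - 1))
  mirrorNode := Node₃.mirror
  mirrorArc := Arc₃.mirror
  mirrorNode_mirrorNode v := by cases v <;> rfl
  mirrorArc_mirrorArc i := by cases i <;> rfl
  len_mirrorArc i := by cases i <;> rfl
  src_mirrorArc i := by cases i <;> rfl
  tgt_mirrorArc i := by cases i <;> rfl

/-- The word at the node of the first figure: the suffix (and prefix) of length `L`
of `p^{(0)}`. -/
def nodeWord₁ {A : Type u} (a : ℕ → A) (n : ℕ → ℕ) (L : ℕ) : Unit → List A :=
  fun _ => (block a n 1).rtake L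

/-- `u₁` and `v₁` are the prefix and the suffix of length `L` of `p^{(k)}`. -/
def nodeWord₂ {A : Type u} (a : ℕ → A) (n : ℕ → ℕ) (k L : ℕ) : Node₂ → List A
  | .u₁ => (block a n (k + 1)).take L
  | .v₁ => (block a n (k + 1)).rtake L

/-- `u₁` and `v₁` are the prefix and the suffix of length `L` of `p^{(k)}`, and `u₂` and `v₂` those
of `p^{(k-1)} aₖ₋₁ p^{(k-1)}`. -/
def nodeWord₃ {A : Type u} (a : ℕ → A) (n : ℕ → ℕ) (k L : ℕ) : Node₃ → List A
  | .u₁ => (block a n (k + 1)).take L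
  | .v₁ => (block a n (k + 1)).rtake L
  | .u₂ => (block a n k ++ a (k - 1) :: block a n k).take L
  | .v₂ => (block a n k ++ a (k - 1) :: block a n k).rtake L

end Diagrams

end ToeplitzRauzy

open ToeplitzRauzy

/-!
Every word of `X` is a factor of `ω` itself (`mem_language_subshiftOf`), so the vertices and the edges
of the de Bruijn graph are the factors ("windows") of `ω` of the lengths `L` and `L + 1`. Fix `k` with
`|p^{(k-1)}| + 1 ≤ L ≤ |p^{(k)}|`, where `k = 0` is the case of the first figure. After `k` filling
steps `ω` consists of blocks `p^{(k-1)}`, which are separated by holes at the distance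
`P = |p^{(k-1)}| + 1`. A window of length at most `|p^{(k)}| + 1` contains at most one hole which is
still open after `k + 1` steps; all its other holes carry `aₖ`. Hence it is determined by its position
modulo `P` if all its holes carry `aₖ` (type `pure`), and otherwise by the letter `b ≠ aₖ` and the
index at which `b` stands (type `spot`).

Conversely, the type can be read off from the window if its position modulo `P` can, and this
recognizability is decided by `IsSimpleToeplitzWord.dvd_sub_or_holesAre`: two occurrences of the same
word at positions that differ modulo `P` force, by induction on the number of steps, all holes of the
previous step in this word to carry `aₖ₋₁`. Such a word sits in `p^{(k-1)} aₖ₋₁ p^{(k-1)}` at two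
different places, which bounds its length. This is the situation of the third figure, where the
windows inside `p^{(k-1)} aₖ₋₁ p^{(k-1)}` get a type of their own (type `inner`), given by the
position modulo `|p^{(k-2)}| + 1`. In all cases two windows are equal if and only if their types are
equal (`IsSimpleToeplitzWord.window_eq_iff`).

Each arc of a figure is laid along a stretch of `ω`, so that its vertices and edges are the windows at
consecutive positions. The types run through `pure` along the middle path and the bottommost arc,
through `spot b` along the arc for `b`, and through `inner` along the two inner arcs; comparing
types shows that each vertex and each edge is met exactly once
(`ArcDiagram.Layout.depictsSymmetrically`). Finally, outside its holes `ω` is symmetric under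
each reflection that preserves the set of holes (`IsSimpleToeplitzWord.apply_eq_of_dvd_add`). Applied to
the stretches of `ω` along which the arcs are laid, this turns reversal of words into the reflection of
the figure, and a palindrome is a fixed point of it.
-/

namespace ToeplitzRauzy

/-! ### Windows of an infinite word -/

section Window

variable {A : Type*}

/-- The factor `ω j ⋯ ω (j + M - 1)` of the two-sided infinite word `ω`. -/
def window (ω : ℤ → A) (M : ℕ) (j : ℤ) : List A := List.ofFn fun i : Fin M => ω (j + i)

variable {ω : ℤ → A} {M N : ℕ} {j j' : ℤ}

@[simp]
theorem length_window : (window ω M j).length = M := by simp [window]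

theorem window_eq_window_iff :
    window ω M j = window ω M j' ↔ ∀ i : ℤ, 0 ≤ i → i < M → ω (j + i) = ω (j' + i) := by
  rw [window, window, List.ofFn_inj, funext_iff]
  constructor
  · intro h i h0 h1
    lift i to ℕ using h0
    exact h ⟨i, by exact_mod_cast h1⟩
  · intro h i
    exact h i (by positivity) (by exact_mod_cast i.2)

theorem window_add : window ω (M + N) j = window ω M j ++ window ω N (j + M) := by
  rw [window, window, window, List.ofFn_add]
  congr 2
  funext i
  simp [add_assoc]

theorem window_succ : window ω (M + 1) j = window ω M j ++ [ω (j + M)] := by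
  rw [window_add]; simp [window]

theorem window_succ' : window ω (M + 1) j = ω j :: window ω M (j + 1) := by
  rw [add_comm, window_add]; simp [window]

theorem take_window (h : N ≤ M) : (window ω M j).take N = window ω N j := by
  obtain ⟨t, rfl⟩ := Nat.exists_eq_add_of_le h
  rw [window_add, List.take_append_of_le_length (by simp), List.take_of_length_le (by simp)]

theorem rtake_window (h : N ≤ M) : (window ω M j).rtake N = window ω N (j + M - N) := by
  obtain ⟨t, rfl⟩ := Nat.exists_eq_add_of_le' h
  rw [List.rtake, length_window, Nat.add_sub_cancel, window_add, List.drop_left' (by simp)]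
  congr 1
  push_cast; ring

theorem window_reverse {S : ℤ}
    (h : ∀ y, j ≤ y → y < j + M → ω y = ω (S - y)) :
    (window ω M j).reverse = window ω M (S + 1 - M - j) := by
  apply List.ext_getElem (by simp)
  intro i h1 h2
  simp only [length_window, List.length_reverse] at h1 h2
  simp only [window, List.getElem_reverse, List.length_ofFn, List.getElem_ofFn]
  rw [h _ (by omega) (by omega)]
  congr 1
  omega

theorem occursIn_iff {w : List A} : OccursIn w ω ↔ ∃ j, w = window ω w.length j := by
  refine exists_congr fun j => ?_
  constructor
  · intro h
    exact List.ext_getElem (by simp) fun i h1 h2 => by simp [window, h i h1]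
  · intro h i hi
    have := List.getElem_of_eq h hi
    simpa [window] using this

theorem shift_iterate (k : ℕ) (ρ : ℤ → A) (j : ℤ) : shift^[k] ρ j = ρ (j + k) := by
  induction k generalizing ρ with
  | zero => simp
  | succ k ih => rw [Function.iterate_succ_apply, ih, shift]; congr 1; push_cast; ring

/-- Every word of the subshift is a factor of `ω` itself: a cylinder is open, and shifting moves a
factor of `ω`, wherever it stands, into sight. -/
theorem mem_language_subshiftOf [TopologicalSpace A] [DiscreteTopology A] {w : List A} :
    w ∈ language (subshiftOf ω) ↔ ∃ j, w = window ω w.length j := by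
  rw [← occursIn_iff]
  constructor
  · rintro ⟨ρ, hρ, j, hj⟩
    have hopen : IsOpen {σ : ℤ → A | ∀ i : Fin w.length, σ (j + i) = ρ (j + i)} := by
      have : {σ : ℤ → A | ∀ i : Fin w.length, σ (j + i) = ρ (j + i)}
          = ⋂ i : Fin w.length, (fun σ : ℤ → A => σ (j + i)) ⁻¹' {ρ (j + i)} := by
        ext σ; simp
      rw [this]
      exact isOpen_iInter_of_finite fun i =>
        (isOpen_discrete _).preimage (continuous_apply (j + (i : ℤ)))
    obtain ⟨σ, hσ, k, -, rfl⟩ := mem_closure_iff.1 hρ _ hopen fun _ => rfl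
    refine ⟨j + k, fun i hi => ?_⟩
    rw [hj i hi, ← hσ ⟨i, hi⟩, shift_iterate]
    congr 1; ring
  · rintro ⟨j, hj⟩
    refine ⟨shift^[1] ω, subset_closure ⟨1, le_rfl, rfl⟩, j - 1, fun i hi => ?_⟩
    rw [hj i hi, shift_iterate]
    congr 1; push_cast; ring

end Window

/-! ### Holes -/

section Holes

variable {A : Type*} {a : ℕ → A} {n r : ℕ → ℕ} {ω : ℤ → A} {m M : ℕ} {h j j' x y c : ℤ}

/-- The position `j` is still a hole after `m` filling steps. -/
def IsHole (n r : ℕ → ℕ) (m : ℕ) (j : ℤ) : Prop := (holePeriod n m : ℤ) ∣ j - holeOffset n r m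

theorem holePeriod_succ : (holePeriod n (m + 1) : ℤ) = holePeriod n m * n m := by
  simp [holePeriod, Finset.prod_range_succ]

theorem holeOffset_succ :
    (holeOffset n r (m + 1) : ℤ) = holeOffset n r m + r m * holePeriod n m := by
  simp [holeOffset, Finset.sum_range_succ]

theorem _root_.Dvd.dvd.of_eq {x y z : ℤ} (h : x ∣ y) (e : y = z) : x ∣ z := e ▸ h

theorem isHole_zero : IsHole n r 0 j := by simp [IsHole, holePeriod]

theorem isHole_holeOffset : IsHole n r m (holeOffset n r m) := by simp [IsHole]

theorem IsHole.iff_dvd (hh : IsHole n r m h) : IsHole n r m x ↔ (holePeriod n m : ℤ) ∣ x - h := by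
  unfold IsHole at *
  rw [← dvd_sub_left hh]
  congr! 1; ring

theorem IsHole.iff_dvd' (hh : IsHole n r m h) : IsHole n r m x ↔ (holePeriod n m : ℤ) ∣ h - x := by
  rw [hh.iff_dvd, ← dvd_neg, neg_sub]

theorem IsHole.of_succ (hj : IsHole n r (m + 1) j) : IsHole n r m j := by
  obtain ⟨q, hq⟩ := hj
  rw [holePeriod_succ, holeOffset_succ] at hq
  exact ⟨n m * q + r m, by linear_combination hq⟩

theorem holePeriod_dvd_succ : (holePeriod n m : ℤ) ∣ holePeriod n (m + 1) :=
  ⟨n m, holePeriod_succ⟩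

namespace IsCoding

theorem holePeriod_pos (hc : IsCoding a n r) (m : ℕ) : (0 : ℤ) < holePeriod n m := by
  have : 0 < holePeriod n m := Finset.prod_pos fun i _ => by have := hc.two_le i; omega
  exact_mod_cast this

theorem two_mul_holePeriod_le (hc : IsCoding a n r) (m : ℕ) :
    2 * (holePeriod n m : ℤ) ≤ holePeriod n (m + 1) := by
  have := hc.holePeriod_pos m
  have h2 : (2 : ℤ) ≤ n m := by exact_mod_cast hc.two_le m
  rw [holePeriod_succ]; nlinarith

theorem exists_isHole (hc : IsCoding a n r) (m : ℕ) (j : ℤ) :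
    ∃ h, IsHole n r m h ∧ j ≤ h ∧ h < j + holePeriod n m := by
  have hP := hc.holePeriod_pos m
  refine ⟨j + (holeOffset n r m - j) % holePeriod n m, ?_,
    by linarith [Int.emod_nonneg (holeOffset n r m - j) hP.ne'],
    by linarith [Int.emod_lt_of_pos (holeOffset n r m - j) hP]⟩
  exact ⟨-((holeOffset n r m - j) / holePeriod n m),
    by linear_combination Int.emod_add_mul_ediv (holeOffset n r m - j) (holePeriod n m)⟩

end IsCoding

theorem IsHole.eq (hx : IsHole n r m x) (hy : IsHole n r m y)
    (h1 : x < y + holePeriod n m) (h2 : y < x + holePeriod n m) : x = y := by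
  have := Int.eq_zero_of_abs_lt_dvd (hy.iff_dvd.1 hx) (by rw [abs_lt]; constructor <;> linarith)
  linarith

namespace IsSimpleToeplitzWord

theorem apply_eq (hω : IsSimpleToeplitzWord a n r ω) (hc : IsCoding a n r)
    (h1 : IsHole n r m j) (h2 : ¬ IsHole n r (m + 1) j) : ω j = a m := by
  rw [IsHole, ← holeWord_eq_none_iff a n r hc.two_le] at h2
  refine hω.determined (m + 1) j _ ?_
  have h3 : holeWord a n r (m + 1) j
      = periodicWord (a m) (n m) (r m) ((j - holeOffset n r m) / holePeriod n m) := by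
    simp only [holeWord, fill]
    exact if_pos h1
  rw [h3, periodicWord] at h2 ⊢
  split_ifs at h2 ⊢ <;> simp_all

theorem isHole_succ_of_ne (hω : IsSimpleToeplitzWord a n r ω) (hc : IsCoding a n r)
    (h1 : IsHole n r m j) (h2 : ω j ≠ a m) : IsHole n r (m + 1) j := by
  by_contra h; exact h2 (hω.apply_eq hc h1 h)

theorem apply_mem (hω : IsSimpleToeplitzWord a n r ω) (hc : IsCoding a n r)
    (h1 : IsHole n r m j) : ω j ∈ tailAlphabet a m := by
  by_cases h : ∀ t, IsHole n r (m + t) j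
  · obtain ⟨b, hb, hb'⟩ := hω.undetermined
    rw [hb' j fun m' => ?_]
    · exact Set.mem_iInter.1 hb m
    · rw [holeWord_eq_none_iff a n r hc.two_le]
      have key : ∀ t i, IsHole n r (i + t) j → IsHole n r i j := by
        intro t
        induction t with
        | zero => exact fun i => id
        | succ t ih => exact fun i hi => ih i (IsHole.of_succ hi)
      exact key m m' (by rw [add_comm]; exact h m')
  · push Not at h
    classical
    obtain ⟨t, ht, hmin⟩ : ∃ t, ¬ IsHole n r (m + t) j ∧ ∀ s < t, IsHole n r (m + s) j :=
      ⟨Nat.find h, Nat.find_spec h, fun s hs => not_not.1 (Nat.find_min h hs)⟩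
    cases t with
    | zero => exact absurd h1 ht
    | succ t => exact ⟨m + t, by omega, (hω.apply_eq hc (hmin t (by omega)) ht).symm⟩

theorem exists_apply_eq (hω : IsSimpleToeplitzWord a n r ω) (hc : IsCoding a n r)
    {b : A} (hb : b ∈ tailAlphabet a m) : ∃ h, IsHole n r m h ∧ ω h = b := by
  obtain ⟨k, hk, rfl⟩ := hb
  have hP := hc.holePeriod_pos k
  have h2 := hc.two_mul_holePeriod_le k
  refine ⟨holeOffset n r (k + 1) + holePeriod n k, ?_, hω.apply_eq hc (m := k) ?_ ?_⟩
  · have key : ∀ x, IsHole n r k x → IsHole n r m x := by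
      induction k, hk using Nat.le_induction with
      | base => exact fun x => id
      | succ k hk ih => exact fun x hx => ih (hc.holePeriod_pos k) (hc.two_mul_holePeriod_le k) x hx.of_succ
    apply key
    rw [isHole_holeOffset.of_succ.iff_dvd]; simp
  · rw [isHole_holeOffset.of_succ.iff_dvd]; simp
  · rw [isHole_holeOffset.iff_dvd, add_sub_cancel_left]
    intro h
    have := Int.le_of_dvd hP h
    linarith

/-- Outside the holes of step `m`, the word has period `holePeriod n m`. -/
theorem apply_eq_of_dvd_sub (hω : IsSimpleToeplitzWord a n r ω) (hc : IsCoding a n r)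
    (h1 : (holePeriod n m : ℤ) ∣ x - y) (h2 : ¬ IsHole n r m x) : ω x = ω y := by
  induction m with
  | zero => exact absurd isHole_zero h2
  | succ m ih =>
    have h3 := holePeriod_dvd_succ.trans h1
    have h5 : ¬ IsHole n r (m + 1) y := fun h => h2 (h.iff_dvd.2 h1)
    by_cases h4 : IsHole n r m x
    · rw [hω.apply_eq hc h4 h2, hω.apply_eq hc _ h5]
      exact h4.iff_dvd.2 (by rw [← dvd_neg]; simpa using h3)
    · exact ih h3 h4

/-- Outside the holes of step `m`, the word is invariant under the reflections which preserve the
set of these holes. -/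
theorem apply_eq_of_dvd_add (hω : IsSimpleToeplitzWord a n r ω) (hc : IsCoding a n r)
    (h1 : (holePeriod n m : ℤ) ∣ x + y - 2 * holeOffset n r m) (h2 : ¬ IsHole n r m x) :
    ω x = ω y := by
  induction m with
  | zero => exact absurd isHole_zero h2
  | succ m ih =>
    have key : ∀ {i}, (holePeriod n i : ℤ) ∣ x + y - 2 * holeOffset n r i →
        (IsHole n r i y → IsHole n r i x) ∧ (IsHole n r i x → IsHole n r i y) := by
      intro i hi
      constructor <;> rintro ⟨q, hq⟩ <;> obtain ⟨p, hp⟩ := hi <;>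
        exact ⟨p - q, by linear_combination hp - hq⟩
    have h3 : (holePeriod n m : ℤ) ∣ x + y - 2 * holeOffset n r m := by
      obtain ⟨q, hq⟩ := h1
      rw [holePeriod_succ, holeOffset_succ] at hq
      exact ⟨n m * q + 2 * r m, by linear_combination hq⟩
    by_cases h4 : IsHole n r m x
    · rw [hω.apply_eq hc h4 h2, hω.apply_eq hc ((key h3).2 h4) fun h => h2 ((key h1).1 h)]
    · exact ih h3 h4

end IsSimpleToeplitzWord

theorem length_block (hc : IsCoding a n r) (m : ℕ) :
    ((block a n m).length : ℤ) = holePeriod n m - 1 := by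
  induction m with
  | zero => simp [block, holePeriod]
  | succ m ih =>
    have := hc.two_le m
    rw [holePeriod_succ]
    simp only [block, List.length_append, List.length_flatten, List.map_replicate,
      List.sum_replicate, List.length_cons, smul_eq_mul]
    push_cast [Nat.cast_sub (show 1 ≤ n m by omega)]
    rw [ih]; ring

/-- The word `p^{(m-1)}` is what stands between two consecutive holes of step `m`. -/
theorem IsSimpleToeplitzWord.block_eq (hω : IsSimpleToeplitzWord a n r ω) (hc : IsCoding a n r)
    (hh : IsHole n r m h) : block a n m = window ω (block a n m).length (h + 1) := by
  induction m generalizing h with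
  | zero => simp [block, window]
  | succ m ih =>
    have hP := hc.holePeriod_pos m
    have key : ∀ t : ℕ, (t : ℤ) < n m → block a n m ++
        (List.replicate t (a m :: block a n m)).flatten =
          window ω ((block a n m).length + t * (holePeriod n m)) (h + 1) := by
      intro t
      induction t with
      | zero => intro _; simpa using ih hh.of_succ
      | succ t iht =>
        intro ht
        push_cast at ht
        have e : (block a n m).length + (t + 1) * holePeriod n m
            = ((block a n m).length + t * holePeriod n m) + ((block a n m).length + 1) := by
          zify; rw [length_block hc]; ring
        have hx : IsHole n r m (h + (t + 1) * holePeriod n m) := by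
          rw [hh.of_succ.iff_dvd]; simp
        rw [List.replicate_succ', List.flatten_append, ← List.append_assoc, iht (by omega), e,
          window_add (N := _ + 1), window_succ', ih hx]
        simp only [List.flatten_singleton, length_window]
        have e2 : h + 1 + (((block a n m).length + t * holePeriod n m : ℕ) : ℤ)
            = h + (t + 1) * holePeriod n m := by
          push_cast; rw [length_block hc]; ring
        rw [e2, hω.apply_eq hc hx]
        rw [hh.iff_dvd, add_sub_cancel_left, holePeriod_succ]
        intro hd
        have := Int.le_of_dvd (by positivity) hd
        nlinarith
    have h2 := hc.two_le m
    have e : (block a n (m + 1)).length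
        = (block a n m).length + (n m - 1) * (holePeriod n m) := by
      zify [show 1 ≤ n m by omega]; rw [length_block hc, length_block hc, holePeriod_succ]; ring
    rw [e, ← key (n m - 1) (by omega), block]

end Holes

/-! ### Recognizability -/

section Recognizability

variable {A : Type*} {a : ℕ → A} {n r : ℕ → ℕ} {ω : ℤ → A} {m M : ℕ} {h j j' : ℤ} {c : A}

/-- Within the window of length `M` at `j`, all holes of step `m` are filled with the letter `c`. -/
def HolesAre (n r : ℕ → ℕ) (ω : ℤ → A) (m : ℕ) (c : A) (M : ℕ) (j : ℤ) : Prop :=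
  ∀ x, j ≤ x → x < j + M → IsHole n r m x → ω x = c

theorem HolesAre.succ (hH : HolesAre n r ω m c M j) : HolesAre n r ω (m + 1) c M j :=
  fun x h1 h2 h3 => hH x h1 h2 h3.of_succ

namespace IsSimpleToeplitzWord

theorem holesAre_of_holesAre_succ (hω : IsSimpleToeplitzWord a n r ω) (hc : IsCoding a n r)
    (hH : HolesAre n r ω (m + 1) (a m) M j) : HolesAre n r ω m (a m) M j := by
  intro x h1 h2 h3
  by_contra h4
  exact h4 (hH x h1 h2 (hω.isHole_succ_of_ne hc h3 h4))

theorem holesAre_of_dvd_of_not_dvd (hω : IsSimpleToeplitzWord a n r ω) (hc : IsCoding a n r)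
    (h1 : (holePeriod n m : ℤ) ∣ j - j') (h2 : ¬ (holePeriod n (m + 1) : ℤ) ∣ j - j')
    (heq : window ω M j = window ω M j') : HolesAre n r ω m (a m) M j := by
  intro x hx1 hx2 hx
  by_contra hne
  have h3 := hω.isHole_succ_of_ne hc hx hne
  have h4 := window_eq_window_iff.1 heq (x - j) (by linarith) (by linarith)
  rw [add_sub_cancel] at h4
  refine hne (h4.trans (hω.apply_eq hc (hx.iff_dvd'.2 ?_) fun h5 => h2 ?_))
  · exact h1.of_eq (by ring)
  · rw [h3.iff_dvd'] at h5; exact h5.of_eq (by ring)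

/-- Two consecutive holes of step `m + 1` cannot both be filled with `a m`, since one of them is
filled with `a (m + 1)` in the next step. -/
theorem false_of_two_holes (hω : IsSimpleToeplitzWord a n r ω) (hc : IsCoding a n r)
    (hH : HolesAre n r ω (m + 1) (a m) M j)
    (hh : IsHole n r (m + 1) h) (h1 : j ≤ h) (h2 : h + holePeriod n (m + 1) < j + M) : False := by
  have hP := hc.holePeriod_pos (m + 1)
  have h3 : IsHole n r (m + 1) (h + holePeriod n (m + 1)) := hh.iff_dvd.2 (by simp)
  have e1 := hω.isHole_succ_of_ne hc hh
    (by rw [hH h h1 (by linarith) hh]; exact hc.ne_succ m)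
  have e2 := hω.isHole_succ_of_ne hc h3
    (by rw [hH _ (by linarith) h2 h3]; exact hc.ne_succ m)
  have := e1.eq e2 (by linarith) (by linarith [hc.two_mul_holePeriod_le (m + 1)])
  linarith

theorem dvd_sub_of_window_eq (hω : IsSimpleToeplitzWord a n r ω) (hc : IsCoding a n r)
    (hM : 2 * (holePeriod n m : ℤ) ≤ M) (heq : window ω M j = window ω M j') :
    (holePeriod n m : ℤ) ∣ j - j' := by
  induction m with
  | zero => simp [holePeriod]
  | succ m ih =>
    by_contra hnd
    have hP := hc.holePeriod_pos m
    have h1 := ih (by linarith [hc.two_mul_holePeriod_le m])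
    have h2 := (hω.holesAre_of_dvd_of_not_dvd hc h1 hnd heq).succ
    obtain ⟨h, hh, h3, h4⟩ := hc.exists_isHole (m + 1) j
    exact hω.false_of_two_holes hc h2 hh h3 (by linarith)

/-- **Recognizability.** A factor of length at least `|p^{(m)}| + 1` determines its position modulo
this number, except for the short factors of `p^{(m)} a_m p^{(m)}`, which are periodic with the
smaller period `|p^{(m-1)}| + 1`. -/
theorem dvd_sub_or_holesAre (hω : IsSimpleToeplitzWord a n r ω) (hc : IsCoding a n r)
    (hM : (holePeriod n (m + 1) : ℤ) ≤ M) (heq : window ω M j = window ω M j') :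
    (holePeriod n (m + 1) : ℤ) ∣ j - j' ∨
      ((holePeriod n m : ℤ) ∣ j - j' ∧ HolesAre n r ω (m + 1) (a m) M j ∧
        HolesAre n r ω (m + 1) (a m) M j' ∧ a m ∈ tailAlphabet a (m + 1) ∧
        (M : ℤ) + holePeriod n m < 2 * holePeriod n (m + 1)) := by
  by_cases hd : (holePeriod n (m + 1) : ℤ) ∣ j - j'
  · exact Or.inl hd
  have hd' : ¬ (holePeriod n (m + 1) : ℤ) ∣ j' - j := by rwa [← dvd_neg, neg_sub]
  have hP := hc.holePeriod_pos m
  have h1 := hω.dvd_sub_of_window_eq hc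
    (by linarith [hc.two_mul_holePeriod_le m]) heq
  have h1' : (holePeriod n m : ℤ) ∣ j' - j := by rwa [← dvd_neg, neg_sub]
  have h2 := (hω.holesAre_of_dvd_of_not_dvd hc h1 hd heq).succ
  have h2' := (hω.holesAre_of_dvd_of_not_dvd hc h1' hd' heq.symm).succ
  obtain ⟨h, hh, h3, h4⟩ := hc.exists_isHole (m + 1) j
  obtain ⟨h', hh', h3', h4'⟩ := hc.exists_isHole (m + 1) j'
  refine Or.inr ⟨h1, h2, h2', ?_, ?_⟩
  · rw [← h2 h h3 (by linarith) hh]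
    exact hω.apply_mem hc hh
  · have e : j + M ≤ h + holePeriod n (m + 1) := by
      by_contra hlt
      exact hω.false_of_two_holes hc h2 hh h3 (by linarith)
    have e' : j' + M ≤ h' + holePeriod n (m + 1) := by
      by_contra hlt
      exact hω.false_of_two_holes hc h2' hh' h3' (by linarith)
    -- the two windows sit in `p^{(m)} a_m p^{(m)}` at different offsets of the same phase
    have hoff : (holePeriod n m : ℤ) ∣ (j - h) - (j' - h') := by
      have := dvd_add h1 (hh.of_succ.iff_dvd.1 hh'.of_succ)
      exact this.of_eq (by ring)
    by_contra hlt
    have h0 := Int.eq_zero_of_abs_lt_dvd hoff (by rw [abs_lt]; constructor <;> linarith)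
    apply hd
    have := hh.iff_dvd'.1 hh'
    exact this.of_eq (by linarith)

end IsSimpleToeplitzWord
end Recognizability

/-! ### Types of windows -/

section Types

variable {A : Type*} {a : ℕ → A} {n r : ℕ → ℕ} {ω : ℤ → A} {k M : ℕ} {j j' : ℤ} {E : Prop}

/-- The possible shapes of a factor `w` with `|p^{(k-1)}| + 1 ≤ |w| ≤ |p^{(k)}| + 1`. The numbers are
integers, as are the positions in the infinite word. -/
inductive WindowType (A : Type*)
  /-- All holes carry `aₖ`; the window starts `φ` letters after a full block `p^{(k-1)}` starts. -/
  | pure (φ : ℤ)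
  /-- A hole which lies in the window at the index `i` carries the letter `b ≠ aₖ`. -/
  | spot (b : A) (i : ℤ)
  /-- All holes carry `aₖ₋₁`; the window starts `ψ` letters after a block `p^{(k-2)}` starts. -/
  | inner (ψ : ℤ)

/-- The window of length `M` at `j` has the given type with respect to the holes of step `k`. The
proposition `E` tells whether the exceptional type `inner` is in use; if so, it has
precedence over the type `spot`. -/
def HasType (a : ℕ → A) (n r : ℕ → ℕ) (ω : ℤ → A) (k : ℕ) (E : Prop) (M : ℕ) (j : ℤ) :
    WindowType A → Prop
  | .pure φ => 0 ≤ φ ∧ φ < holePeriod n k ∧ IsHole n r k (j - 1 - φ) ∧ HolesAre n r ω k (a k) M j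
  | .spot b i => 0 ≤ i ∧ i < M ∧ IsHole n r k (j + i) ∧ ω (j + i) = b ∧ b ≠ a k ∧
      ¬ (E ∧ HolesAre n r ω k (a (k - 1)) M j)
  | .inner ψ => E ∧ 0 ≤ ψ ∧ ψ < holePeriod n (k - 1) ∧ IsHole n r (k - 1) (j - 1 - ψ) ∧
      HolesAre n r ω k (a (k - 1)) M j

namespace IsSimpleToeplitzWord

theorem _root_.ToeplitzRauzy.IsCoding.exists_hasType (hc : IsCoding a n r) (ω : ℤ → A) (k M : ℕ)
    (E : Prop) (j : ℤ) : ∃ κ, HasType a n r ω k E M j κ := by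
  have start : ∀ m, ∃ φ : ℤ, 0 ≤ φ ∧ φ < holePeriod n m ∧ IsHole n r m (j - 1 - φ) := by
    intro m
    obtain ⟨h, hh, h1, h2⟩ := hc.exists_isHole m (j - holePeriod n m)
    exact ⟨j - 1 - h, by linarith, by linarith, by rwa [show j - 1 - (j - 1 - h) = h by ring]⟩
  by_cases h1 : E ∧ HolesAre n r ω k (a (k - 1)) M j
  · obtain ⟨ψ, h2, h3, h4⟩ := start (k - 1)
    exact ⟨.inner ψ, h1.1, h2, h3, h4, h1.2⟩
  by_cases h2 : HolesAre n r ω k (a k) M j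
  · obtain ⟨φ, h3, h4, h5⟩ := start k
    exact ⟨.pure φ, h3, h4, h5, h2⟩
  · simp only [HolesAre, not_forall] at h2
    obtain ⟨x, h3, h4, h5, h6⟩ := h2
    exact ⟨.spot (ω x) (x - j), by linarith, by linarith, by simpa using h5, by simp, h6, h1⟩

theorem window_eq_of_holesAre (hω : IsSimpleToeplitzWord a n r ω) (hc : IsCoding a n r) {c : A}
    {m : ℕ} (h1 : HolesAre n r ω m c M j) (h2 : HolesAre n r ω m c M j')
    (hd : (holePeriod n m : ℤ) ∣ j - j') : window ω M j = window ω M j' := by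
  refine window_eq_window_iff.2 fun i hi0 hiM => ?_
  have hd' : (holePeriod n m : ℤ) ∣ (j + i) - (j' + i) := by
    exact hd.of_eq (by ring)
  by_cases hh : IsHole n r m (j + i)
  · rw [h1 _ (by linarith) (by linarith) hh, h2 _ (by linarith) (by linarith)]
    rw [hh.iff_dvd']
    exact hd'.of_eq (by ring)
  · exact hω.apply_eq_of_dvd_sub hc hd' hh

/-- The type classifies the windows: being of the same type is being the same word. If the type
`inner` is not in use, recognizability (`hrec`) has to hold without exception. -/
theorem window_eq_iff (hω : IsSimpleToeplitzWord a n r ω) (hc : IsCoding a n r)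
    (hM : (holePeriod n k : ℤ) ≤ M) (hM' : (M : ℤ) ≤ holePeriod n (k + 1)) (hE : E → 1 ≤ k)
    (hrec : ¬ E → ∀ j j', window ω M j = window ω M j' → (holePeriod n k : ℤ) ∣ j - j')
    {κ κ' : WindowType A} (h : HasType a n r ω k E M j κ) (h' : HasType a n r ω k E M j' κ') :
    window ω M j = window ω M j' ↔ κ = κ' := by
  have hP := hc.holePeriod_pos k
  constructor
  · intro heq
    have hcase : (holePeriod n k : ℤ) ∣ j - j' ∨ (E ∧ (holePeriod n (k - 1) : ℤ) ∣ j - j' ∧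
        HolesAre n r ω k (a (k - 1)) M j ∧ HolesAre n r ω k (a (k - 1)) M j') := by
      by_cases e : E
      · obtain ⟨m, rfl⟩ := Nat.exists_eq_add_of_le' (hE e)
        rcases hω.dvd_sub_or_holesAre hc hM heq with h1 | ⟨h1, h2, h3, -, -⟩
        · exact Or.inl h1
        · exact Or.inr ⟨e, h1, h2, h3⟩
      · exact Or.inl (hrec e j j' heq)
    have heq' := window_eq_window_iff.1 heq
    -- the window contains a hole, whose letter cannot be both `a (k - 1)` and `a k`
    have clash : ∀ {j}, E → HolesAre n r ω k (a (k - 1)) M j →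
        HolesAre n r ω k (a k) M j → False := by
      intro j e h1 h2
      obtain ⟨x, hx, hx1, hx2⟩ := hc.exists_isHole k j
      have h3 := hc.ne_succ (k - 1)
      rw [Nat.sub_add_cancel (hE e)] at h3
      exact h3 ((h1 x hx1 (by linarith) hx).symm.trans (h2 x hx1 (by linarith) hx))
    have uniq : ∀ {m} {φ φ' : ℤ}, 0 ≤ φ → φ < holePeriod n m → 0 ≤ φ' → φ' < holePeriod n m →
        (holePeriod n m : ℤ) ∣ j - j' →
        IsHole n r m (j - 1 - φ) → IsHole n r m (j' - 1 - φ') → φ = φ' := by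
      intro m φ φ' h1 h2 h3 h4 hd h5 h6
      have h7 : IsHole n r m (j - 1 - φ') := by
        rw [h6.iff_dvd]; exact hd.of_eq (by ring)
      linarith [h5.eq h7 (by linarith) (by linarith)]
    rcases hcase with hd | ⟨e, hd, hI, hI'⟩
    · have hole : ∀ i, IsHole n r k (j + i) ↔ IsHole n r k (j' + i) := by
        intro i
        have hd' : (holePeriod n k : ℤ) ∣ (j + i) - (j' + i) := by
          exact hd.of_eq (by ring)
        constructor <;> intro h
        · rw [h.iff_dvd']; exact hd'.of_eq (by ring)
        · rw [h.iff_dvd]; exact hd'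
      have trans : ∀ {c}, HolesAre n r ω k c M j ↔ HolesAre n r ω k c M j' := by
        intro c
        constructor <;> intro h x hx1 hx2 hx
        · have := heq' (x - j') (by linarith) (by linarith)
          rw [add_sub_cancel] at this
          rw [← this]
          exact h _ (by linarith) (by linarith) ((hole _).2 (by simpa using hx))
        · have := heq' (x - j) (by linarith) (by linarith)
          rw [add_sub_cancel] at this
          rw [this]
          exact h _ (by linarith) (by linarith) ((hole _).1 (by simpa using hx))
      match κ, κ', h, h' with
      | .pure φ, .pure φ', ⟨h1, h2, h3, _⟩, ⟨h1', h2', h3', _⟩ =>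
        rw [uniq h1 h2 h1' h2' hd h3 h3']
      | .pure φ, .spot b i, ⟨_, _, _, h4⟩, ⟨h1, h2, h3, h5, h6, _⟩ =>
        exact absurd (h5.symm.trans (trans.1 h4 _ (by linarith) (by linarith) h3)) h6
      | .spot b i, .pure φ, ⟨h1, h2, h3, h5, h6, _⟩, ⟨_, _, _, h4⟩ =>
        exact absurd (h5.symm.trans (trans.2 h4 _ (by linarith) (by linarith) h3)) h6
      | .pure φ, .inner ψ, ⟨_, _, _, h4⟩, ⟨e, _, _, _, h5⟩ =>
        exact (clash e h5 (trans.1 h4)).elim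
      | .inner ψ, .pure φ, ⟨e, _, _, _, h5⟩, ⟨_, _, _, h4⟩ =>
        exact (clash e h5 (trans.2 h4)).elim
      | .inner ψ, .inner ψ', ⟨_, h1, h2, h3, _⟩, ⟨e, h1', h2', h3', _⟩ =>
        have hd' : (holePeriod n (k - 1) : ℤ) ∣ j - j' := by
          obtain ⟨m, rfl⟩ := Nat.exists_eq_add_of_le' (hE e)
          exact holePeriod_dvd_succ.trans hd
        rw [uniq h1 h2 h1' h2' hd' h3 h3']
      | .spot b i, .inner ψ, ⟨_, _, _, _, _, h1⟩, ⟨e, _, _, _, h2⟩ =>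
        exact absurd ⟨e, trans.2 h2⟩ h1
      | .inner ψ, .spot b i, ⟨e, _, _, _, h2⟩, ⟨_, _, _, _, _, h1⟩ =>
        exact absurd ⟨e, trans.1 h2⟩ h1
      | .spot b i, .spot b' i', ⟨h1, h2, h3, h4, h5, _⟩, ⟨h1', h2', h3', h4', h5', _⟩ =>
        -- both letters stand at holes of step `k + 1`, of which a window has at most one
        have h6 : IsHole n r (k + 1) (j' + i) := by
          refine hω.isHole_succ_of_ne hc ((hole i).1 h3) ?_
          rw [← heq' i h1 h2, h4]; exact h5
        have h7 : IsHole n r (k + 1) (j' + i') := by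
          refine hω.isHole_succ_of_ne hc h3' ?_
          rw [h4']; exact h5'
        have h8 : i = i' := by linarith [h6.eq h7 (by linarith) (by linarith)]
        subst h8
        rw [← h4, ← h4', heq' i h1 h2]
    · match κ, κ', h, h' with
      | .pure φ, _, ⟨_, _, _, h4⟩, _ => exact (clash e hI h4).elim
      | _, .pure φ, _, ⟨_, _, _, h4⟩ => exact (clash e hI' h4).elim
      | .spot _ _, _, ⟨_, _, _, _, _, h1⟩, _ => exact absurd ⟨e, hI⟩ h1
      | _, .spot _ _, _, ⟨_, _, _, _, _, h1⟩ => exact absurd ⟨e, hI'⟩ h1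
      | .inner ψ, .inner ψ', ⟨_, h1, h2, h3, _⟩, ⟨_, h1', h2', h3', _⟩ =>
        rw [uniq h1 h2 h1' h2' hd h3 h3']
  · rintro rfl
    match κ, h, h' with
    | .pure φ, ⟨_, _, h1, h2⟩, ⟨_, _, h1', h2'⟩ =>
      refine hω.window_eq_of_holesAre hc h2 h2' ?_
      rw [h1'.iff_dvd] at h1; exact h1.of_eq (by ring)
    | .inner ψ, ⟨e, _, _, h1, h2⟩, ⟨_, _, _, h1', h2'⟩ =>
      obtain ⟨m, rfl⟩ := Nat.exists_eq_add_of_le' (hE e)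
      refine hω.window_eq_of_holesAre hc (hω.holesAre_of_holesAre_succ hc h2)
        (hω.holesAre_of_holesAre_succ hc h2') ?_
      rw [h1'.iff_dvd] at h1; exact h1.of_eq (by ring)
    | .spot b i, ⟨h1, h2, h3, h4, h5, _⟩, ⟨_, _, h3', h4', _, _⟩ =>
      have h6 := hω.isHole_succ_of_ne hc h3 (by rwa [h4])
      have h6' := hω.isHole_succ_of_ne hc h3' (by rwa [h4'])
      refine window_eq_window_iff.2 fun x hx0 hxM => ?_
      rcases eq_or_ne x i with rfl | hne
      · rw [h4, h4']
      have hd : (holePeriod n k : ℤ) ∣ (j + x) - (j' + x) := by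
        rw [h3'.iff_dvd] at h3; exact h3.of_eq (by ring)
      by_cases hh : IsHole n r k (j + x)
      · have hh' : IsHole n r k (j' + x) := by
          rw [hh.iff_dvd']; exact hd.of_eq (by ring)
        rw [hω.apply_eq hc hh fun h7 => hne
            (by linarith [h7.eq h6 (by linarith) (by linarith)]),
          hω.apply_eq hc hh' fun h7 => hne
            (by linarith [h7.eq h6' (by linarith) (by linarith)])]
      · exact hω.apply_eq_of_dvd_sub hc hd hh

/-- The reverse of a factor is the factor at the reflected position, provided that the
reflection respects the holes and their letters. -/
theorem reverse_window (hω : IsSimpleToeplitzWord a n r ω) (hc : IsCoding a n r) {m : ℕ} {S : ℤ}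
    (hS : (holePeriod n m : ℤ) ∣ S - 2 * holeOffset n r m)
    (hh : ∀ y, j ≤ y → y < j + M → IsHole n r m y → ω y = ω (S - y)) :
    (window ω M j).reverse = window ω M (S + 1 - M - j) := by
  refine window_reverse fun y h1 h2 => ?_
  by_cases h3 : IsHole n r m y
  · exact hh y h1 h2 h3
  · exact hω.apply_eq_of_dvd_add hc (by rwa [add_sub_cancel]) h3

end IsSimpleToeplitzWord
end Types

/-! ### Drawing the graph -/

namespace ArcDiagram

universe u
variable {A : Type u} (D : ArcDiagram A)

theorem point_zero (i : D.Arc) : D.point i 0 = D.node (D.src i) := Quot.sound (Glue.src i)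

theorem point_last (i : D.Arc) : D.point i (Fin.last _) = D.node (D.tgt i) :=
  Quot.sound (Glue.tgt i)

theorem reflect_node (v : D.Node) : D.reflect (D.node v) = D.node (D.mirrorNode v) := rfl

theorem reflect_point (i : D.Arc) (t : Fin (D.len i + 1)) :
    D.reflect (D.point i t) =
      D.point (D.mirrorArc i) (Fin.cast (by rw [D.len_mirrorArc]) (Fin.rev t)) := rfl

theorem node_src_eq_node_tgt {i : D.Arc} (h : D.len i = 0) : D.node (D.src i) = D.node (D.tgt i) := by
  rw [← point_zero, ← point_last]
  congr 1
  ext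
  simp [h]

/-- A way to lay the arcs of the diagram `D` along the infinite word `ω`: the `t`-th vertex of the
arc `i` is the factor of length `L` at the position `s i + t`. The factors of lengths `L` and `L + 1`,
which are the vertices and the edges of the de Bruijn graph, are classified by types in `τ`,
where `HT M j κ` says that the factor of length `M` at `j` has the type `κ`. The type of a node is
`nodeType`, and `arcType i t` is the type of the `t`-th vertex of the arc `i`, if this is an
interior vertex, and also the type of the `t`-th edge. -/
structure Layout (ω : ℤ → A) (L : ℕ) (nodeWord : D.Node → List A) (τ : Type*)
    (HT : ℕ → ℤ → τ → Prop) (s : D.Arc → ℤ) (nodeType : D.Node → τ) (arcType : D.Arc → ℕ → τ) :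
    Prop where
  pos : 1 ≤ L
  window_eq_iff : ∀ M, L ≤ M → M ≤ L + 1 → ∀ j j' κ κ', HT M j κ → HT M j' κ' →
    (window ω M j = window ω M j' ↔ κ = κ')
  exists_hasType : ∀ j, ∃ κ, HT (L + 1) j κ
  node : ∀ v, ∃ j, HT L j (nodeType v) ∧ nodeWord v = window ω L j
  endpoint : ∀ v, ∃ i, D.src i = v ∨ D.tgt i = v
  src : ∀ i, HT L (s i) (nodeType (D.src i))
  tgt : ∀ i, HT L (s i + D.len i) (nodeType (D.tgt i))
  interior : ∀ i (t : ℕ), 0 < t → t < D.len i → HT L (s i + t) (arcType i t)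
  edge : ∀ i (t : ℕ), t < D.len i → HT (L + 1) (s i + t) (arcType i t)
  inj : ∀ i i' t t', t < D.len i → t' < D.len i' → arcType i t = arcType i' t' → i = i' ∧ t = t'
  interior_ne : ∀ i t v, 0 < t → t < D.len i → arcType i t ≠ nodeType v
  surj : ∀ j κ, HT (L + 1) j κ → ∃ i t, t < D.len i ∧ arcType i t = κ
  node_inj : ∀ v v', nodeType v = nodeType v' → D.node v = D.node v'
  axis : ∀ v, nodeType (D.mirrorNode v) = nodeType v →
    D.mirrorNode v = v ∨
      ∃ i, D.mirrorArc i = i ∧ D.len i = 0 ∧ (D.src i = v ∨ D.tgt i = v)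
  label : ∀ i b, D.label i = some b → ω (s i + L) = b
  reverse : ∀ i (t : ℕ), t ≤ D.len i →
    (window ω L (s i + t)).reverse = window ω L (s (D.mirrorArc i) + (D.len i - t))

variable {D} {ω : ℤ → A} {L : ℕ} {nodeWord : D.Node → List A} {τ : Type*}
  {HT : ℕ → ℤ → τ → Prop} {s : D.Arc → ℤ} {nodeType : D.Node → τ} {arcType : D.Arc → ℕ → τ}

theorem exists_eq_point (hD : ∀ v, ∃ i, D.src i = v ∨ D.tgt i = v) (x : D.Vertex) :
    ∃ i t, x = D.point i t := by
  obtain ⟨x, rfl⟩ := Quot.exists_rep x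
  rcases x with v | ⟨i, t⟩
  · obtain ⟨i, rfl | rfl⟩ := hD v
    · exact ⟨i, 0, (D.point_zero i).symm⟩
    · exact ⟨i, Fin.last _, (D.point_last i).symm⟩
  · exact ⟨i, t, rfl⟩

theorem node_or_interior (i : D.Arc) (t : Fin (D.len i + 1)) :
    (∃ v, D.point i t = D.node v) ∨ (0 < (t : ℕ) ∧ (t : ℕ) < D.len i) := by
  rcases eq_or_ne t 0 with rfl | h0
  · exact Or.inl ⟨_, D.point_zero i⟩
  rcases eq_or_ne t (Fin.last _) with rfl | h1
  · exact Or.inl ⟨_, D.point_last i⟩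
  · have := t.2
    simp only [ne_eq, Fin.ext_iff, Fin.val_zero, Fin.val_last] at h0 h1
    exact Or.inr ⟨by omega, by omega⟩

namespace Layout

theorem window_src (h : D.Layout ω L nodeWord τ HT s nodeType arcType) (i : D.Arc) :
    window ω L (s i) = nodeWord (D.src i) := by
  obtain ⟨j, h1, h2⟩ := h.node (D.src i)
  rw [h2]
  exact (h.window_eq_iff L le_rfl (by omega) _ _ _ _ (h.src i) h1).2 rfl

theorem window_tgt (h : D.Layout ω L nodeWord τ HT s nodeType arcType) (i : D.Arc) :
    window ω L (s i + D.len i) = nodeWord (D.tgt i) := by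
  obtain ⟨j, h1, h2⟩ := h.node (D.tgt i)
  rw [h2]
  exact (h.window_eq_iff L le_rfl (by omega) _ _ _ _ (h.tgt i) h1).2 rfl

/-- The word which a layout assigns to a vertex of the diagram. -/
def word (h : D.Layout ω L nodeWord τ HT s nodeType arcType) : D.Vertex → List A :=
  Quot.lift (Sum.elim nodeWord fun p => window ω L (s p.1 + (p.2 : ℕ))) (by
    intro x y hxy
    cases hxy with
    | src i => simpa using h.window_src i
    | tgt i => simpa using h.window_tgt i)

theorem word_node (h : D.Layout ω L nodeWord τ HT s nodeType arcType) (v : D.Node) :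
    h.word (D.node v) = nodeWord v := rfl

theorem word_point (h : D.Layout ω L nodeWord τ HT s nodeType arcType) (i : D.Arc)
    (t : Fin (D.len i + 1)) : h.word (D.point i t) = window ω L (s i + (t : ℕ)) := rfl

theorem node_eq_of_nodeWord_eq (h : D.Layout ω L nodeWord τ HT s nodeType arcType) {v v' : D.Node}
    (hv : nodeWord v = nodeWord v') : nodeType v = nodeType v' := by
  obtain ⟨j, h1, h2⟩ := h.node v
  obtain ⟨j', h1', h2'⟩ := h.node v'
  exact (h.window_eq_iff L le_rfl (by omega) _ _ _ _ h1 h1').1 (by rw [← h2, ← h2', hv])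

theorem window_ne_nodeWord (h : D.Layout ω L nodeWord τ HT s nodeType arcType) {i : D.Arc} {t : ℕ}
    (h0 : 0 < t) (h1 : t < D.len i) (v : D.Node) : window ω L (s i + t) ≠ nodeWord v := by
  obtain ⟨j, h2, h3⟩ := h.node v
  rw [h3]
  intro he
  exact h.interior_ne i t v h0 h1
    ((h.window_eq_iff L le_rfl (by omega) _ _ _ _ (h.interior i t h0 h1) h2).1 he)

theorem interior_inj (h : D.Layout ω L nodeWord τ HT s nodeType arcType) {i i' : D.Arc} {t t' : ℕ}
    (h0 : 0 < t) (h1 : t < D.len i) (h0' : 0 < t') (h1' : t' < D.len i')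
    (he : window ω L (s i + t) = window ω L (s i' + t')) : i = i' ∧ t = t' :=
  h.inj _ _ _ _ h1 h1' <| (h.window_eq_iff L le_rfl (by omega) _ _ _ _
    (h.interior i t h0 h1) (h.interior i' t' h0' h1')).1 he

theorem word_injective (h : D.Layout ω L nodeWord τ HT s nodeType arcType) :
    Function.Injective h.word := by
  intro x x' he
  obtain ⟨i, t, rfl⟩ := exists_eq_point h.endpoint x
  obtain ⟨i', t', rfl⟩ := exists_eq_point h.endpoint x'
  rcases node_or_interior i t with ⟨v, hv⟩ | ⟨h0, h1⟩ <;>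
    rcases node_or_interior i' t' with ⟨v', hv'⟩ | ⟨h0', h1'⟩
  · rw [hv, hv', word_node, word_node] at he
    rw [hv, hv']
    exact h.node_inj _ _ (h.node_eq_of_nodeWord_eq he)
  · rw [hv, word_node] at he
    exact absurd he.symm (h.window_ne_nodeWord h0' h1' v)
  · rw [hv', word_node] at he
    exact absurd he (h.window_ne_nodeWord h0 h1 v')
  · obtain ⟨rfl, ht⟩ := h.interior_inj h0 h1 h0' h1' he
    rw [Fin.ext ht]

theorem exists_edge (h : D.Layout ω L nodeWord τ HT s nodeType arcType) (j : ℤ) :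
    ∃ e : D.Edge, window ω (L + 1) (s e.1 + (e.2 : ℕ)) = window ω (L + 1) j := by
  obtain ⟨κ, hκ⟩ := h.exists_hasType j
  obtain ⟨i, t, ht, rfl⟩ := h.surj j κ hκ
  exact ⟨⟨i, ⟨t, ht⟩⟩,
    (h.window_eq_iff (L + 1) (by omega) le_rfl _ _ _ _ (h.edge i t ht) hκ).2 rfl⟩

theorem edge_inj (h : D.Layout ω L nodeWord τ HT s nodeType arcType) {e e' : D.Edge}
    (he : window ω (L + 1) (s e.1 + (e.2 : ℕ)) = window ω (L + 1) (s e'.1 + (e'.2 : ℕ))) :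
    e = e' := by
  obtain ⟨i, t⟩ := e
  obtain ⟨i', t'⟩ := e'
  obtain ⟨rfl, h2⟩ := h.inj i i' t t' t.2 t'.2 <|
    (h.window_eq_iff (L + 1) (by omega) le_rfl _ _ _ _ (h.edge i t t.2) (h.edge i' t' t'.2)).1 he
  rw [Fin.ext h2]

theorem word_edgeSrc (h : D.Layout ω L nodeWord τ HT s nodeType arcType) (e : D.Edge) :
    h.word (D.edgeSrc e) = window ω L (s e.1 + (e.2 : ℕ)) := rfl

theorem word_edgeTgt (h : D.Layout ω L nodeWord τ HT s nodeType arcType) (e : D.Edge) :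
    h.word (D.edgeTgt e) = window ω L (s e.1 + (e.2 : ℕ) + 1) := by
  rw [edgeTgt, word_point]
  congr 1
  simp [add_assoc]

theorem word_reflect (h : D.Layout ω L nodeWord τ HT s nodeType arcType) (x : D.Vertex) :
    h.word (D.reflect x) = (h.word x).reverse := by
  obtain ⟨i, t, rfl⟩ := exists_eq_point h.endpoint x
  have ht : (t : ℕ) ≤ D.len i := by omega
  rw [reflect_point, word_point, word_point, h.reverse i t ht]
  congr 2
  simp only [Fin.val_cast, Fin.val_rev]
  omega

theorem palindrome_iff_onAxis (h : D.Layout ω L nodeWord τ HT s nodeType arcType) (x : D.Vertex) :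
    (h.word x).Palindrome ↔ D.OnAxis x := by
  rw [List.Palindrome.iff_reverse_eq, ← h.word_reflect]
  constructor
  · intro he
    obtain ⟨i, t, rfl⟩ := exists_eq_point h.endpoint x
    rcases node_or_interior i t with ⟨v, hv⟩ | ⟨h0, h1⟩
    · rw [hv, reflect_node, word_node, word_node] at he
      rw [hv]
      rcases h.axis v (h.node_eq_of_nodeWord_eq he) with hm | ⟨i', hm, hl, rfl | rfl⟩
      · exact Or.inl ⟨v, hm, rfl⟩
      · exact Or.inr ⟨i', 0, hm, by simp [hl], (D.point_zero i').symm⟩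
      · exact Or.inr ⟨i', Fin.last _, hm, by simp [hl], (D.point_last i').symm⟩
    · rw [reflect_point, word_point, word_point] at he
      have hl := D.len_mirrorArc i
      have hval : ((Fin.cast (by rw [D.len_mirrorArc]) (Fin.rev t) :
          Fin (D.len (D.mirrorArc i) + 1)) : ℕ) = D.len i - t := by
        simp only [Fin.val_cast, Fin.val_rev]; omega
      rw [hval] at he
      obtain ⟨h2, h3⟩ := h.interior_inj (by omega) (by omega) h0 h1 he
      exact Or.inr ⟨i, t, h2, by omega, rfl⟩
  · intro hx
    refine congrArg h.word ?_
    rcases hx with ⟨v, hv, rfl⟩ | ⟨i, t, hi, ht, rfl⟩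
    · rw [reflect_node, hv]
    · have key : ∀ (i' : D.Arc) (_ : i' = i) (t' : Fin (D.len i' + 1)), (t' : ℕ) = t →
          D.point i' t' = D.point i t := by
        rintro _ rfl t' ht'
        rw [Fin.ext ht']
      rw [reflect_point]
      refine key _ hi _ ?_
      simp only [Fin.val_cast, Fin.val_rev]
      omega

theorem depictsSymmetrically [TopologicalSpace A] [DiscreteTopology A]
    (h : D.Layout ω L nodeWord τ HT s nodeType arcType) :
    D.DepictsSymmetrically (subshiftOf ω) L nodeWord := by
  have hword : ∀ x, ∃ j, h.word x = window ω L j := by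
    intro x
    obtain ⟨i, t, rfl⟩ := exists_eq_point h.endpoint x
    exact ⟨_, rfl⟩
  let f : D.Vertex → DeBruijnVertex (subshiftOf ω) L := fun x => ⟨h.word x, by
    obtain ⟨j, hj⟩ := hword x
    rw [hj, mem_language_subshiftOf, length_window]
    exact ⟨⟨j, rfl⟩, rfl⟩⟩
  have hf : Function.Bijective f := by
    refine ⟨fun x x' hx => h.word_injective (congrArg Subtype.val hx), ?_⟩
    rintro ⟨w, hw, rfl⟩
    obtain ⟨j, hj⟩ := mem_language_subshiftOf.1 hw
    obtain ⟨e, he⟩ := h.exists_edge j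
    rw [window_succ, window_succ] at he
    exact ⟨D.edgeSrc e, Subtype.ext ((List.append_inj he (by simp)).1.trans hj.symm)⟩
  refine ⟨Equiv.ofBijective f hf, ⟨?_, ?_, fun v => rfl, ?_⟩, h.word_reflect,
    h.palindrome_iff_onAxis⟩
  · intro e
    refine ⟨ω (s e.1 + (e.2 : ℕ) + L), ω (s e.1 + (e.2 : ℕ)), ?_, ?_⟩
    · change h.word (D.edgeSrc e) ++ _ = _ :: h.word (D.edgeTgt e)
      rw [h.word_edgeTgt, h.word_edgeSrc, ← window_succ, ← window_succ']
    · change h.word (D.edgeSrc e) ++ _ ∈ _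
      rw [h.word_edgeSrc, ← window_succ, mem_language_subshiftOf, length_window]
      exact ⟨_, rfl⟩
  · rintro ⟨x, hxX, hx⟩ ⟨y, hyX, hy⟩ ⟨b, c, h1, h2⟩
    simp only at h1 h2
    obtain ⟨j, hj⟩ := mem_language_subshiftOf.1 h2
    rw [List.length_append, hx, List.length_singleton] at hj
    have hx' : x = window ω L j := by
      rw [window_succ] at hj
      exact (List.append_inj hj (by simpa using hx)).1
    have hy' : y = window ω L (j + 1) := by
      rw [h1, window_succ'] at hj
      exact (List.cons.inj hj).2
    have hiff : ∀ e : D.Edge, (f (D.edgeSrc e)).1 = x ∧ (f (D.edgeTgt e)).1 = y ↔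
        window ω (L + 1) (s e.1 + (e.2 : ℕ)) = window ω (L + 1) j := by
      intro e
      change h.word (D.edgeSrc e) = x ∧ h.word (D.edgeTgt e) = y ↔ _
      rw [h.word_edgeSrc, h.word_edgeTgt, hx', hy']
      constructor
      · rintro ⟨e1, e2⟩
        rw [window_succ', window_succ', e2]
        congr 1
        have := window_eq_window_iff.1 e1 0 le_rfl (by exact_mod_cast h.pos)
        simpa using this
      · intro he
        have he' := he
        rw [window_succ, window_succ] at he
        rw [window_succ', window_succ'] at he'
        exact ⟨(List.append_inj he (by simp)).1, (List.cons.inj he').2⟩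
    obtain ⟨e, he⟩ := h.exists_edge j
    have h3 := (hiff e).2 he
    refine ⟨e, ⟨Subtype.ext h3.1, Subtype.ext h3.2⟩, fun e' he' => ?_⟩
    refine h.edge_inj (((hiff e').1 ⟨congrArg Subtype.val he'.1, congrArg Subtype.val he'.2⟩).trans
      he.symm)
  · intro e he b hb
    change h.word (D.edgeTgt e) = (h.word (D.edgeSrc e)).tail ++ _
    rw [h.word_edgeSrc, h.word_edgeTgt, he, ← h.label e.1 b hb]
    obtain ⟨M, rfl⟩ := Nat.exists_eq_add_of_le' h.pos
    rw [window_succ (M := M), window_succ' (M := M)]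
    simp only [Nat.cast_zero, add_zero, List.tail_cons]
    congr 3
    push_cast; ring

end Layout
end ArcDiagram

/-! ### The types along the arcs -/

section Arcs

variable {A : Type*} {a : ℕ → A} {n r : ℕ → ℕ} {ω : ℤ → A} {k L M : ℕ} {h j x t ρ φ s : ℤ} {b c : A}
  {E : Prop}

/-- `ρ` is the remainder of `L` modulo `P`. -/
structure IsResidue (P : ℤ) (L : ℕ) (ρ : ℤ) : Prop where
  nonneg : 0 ≤ ρ
  lt : ρ < P
  dvd : P ∣ L - ρ

namespace IsSimpleToeplitzWord

theorem holesAre_of_between (hω : IsSimpleToeplitzWord a n r ω) (hc : IsCoding a n r)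
    (hh : IsHole n r (k + 1) h) (h1 : h < j) (h2 : j + M ≤ h + holePeriod n (k + 1)) :
    HolesAre n r ω k (a k) M j := by
  intro x hx1 hx2 hx
  refine hω.apply_eq hc hx fun hx' => ?_
  have := hx'.eq hh (by linarith) (by linarith)
  linarith

theorem holesAre_around (hω : IsSimpleToeplitzWord a n r ω) (hc : IsCoding a n r)
    (hh : IsHole n r (k + 1) h) (hak : ω h = a k) (h1 : h - holePeriod n (k + 1) < j)
    (h2 : j + M ≤ h + holePeriod n (k + 1)) : HolesAre n r ω k (a k) M j := by
  intro x hx1 hx2 hx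
  by_cases hx' : IsHole n r (k + 1) x
  · rw [hx'.eq hh (by linarith) (by linarith), hak]
  · exact hω.apply_eq hc hx hx'

theorem hasType_prefix (hω : IsSimpleToeplitzWord a n r ω) (hc : IsCoding a n r)
    (hL : (L : ℤ) < holePeriod n (k + 1)) (hh : IsHole n r (k + 1) h) (hj : j = h + 1) :
    HasType a n r ω k E L j (.pure 0) := by
  refine ⟨le_rfl, hc.holePeriod_pos k, ?_, hω.holesAre_of_between hc hh ?_ ?_⟩
  · rw [hj]; simpa using hh.of_succ
  all_goals linarith

theorem hasType_suffix (hω : IsSimpleToeplitzWord a n r ω) (hc : IsCoding a n r)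
    (hρ : IsResidue (holePeriod n k) L ρ)
    (hL : (L : ℤ) < holePeriod n (k + 1)) (hh : IsHole n r (k + 1) h) (hj : j = h - L) :
    HasType a n r ω k E L j (.pure (holePeriod n k - 1 - ρ)) := by
  have h0 := hρ.nonneg
  have h1 := hρ.lt
  obtain ⟨q, hq⟩ := hρ.dvd
  refine ⟨by linarith, by linarith, ?_, ?_⟩
  · exact hh.of_succ.iff_dvd.2 ⟨-q - 1, by rw [hj]; linear_combination -hq⟩
  · refine hω.holesAre_of_between hc (h := h - holePeriod n (k + 1)) (hh.iff_dvd.2 (by simp)) ?_ ?_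
      <;> linarith

/-- There is room for one more block `p^{(k-1)}`. -/
theorem _root_.ToeplitzRauzy.IsResidue.add_le (hρ : IsResidue (holePeriod n k) L ρ)
    (hL : (L : ℤ) < holePeriod n (k + 1)) :
    L - ρ + holePeriod n k ≤ holePeriod n (k + 1) := by
  have := Int.le_of_dvd (by linarith [hρ.nonneg])
    (dvd_sub (holePeriod_dvd_succ (n := n) (m := k)) hρ.dvd)
  linarith

theorem hasType_middle (hω : IsSimpleToeplitzWord a n r ω) (hc : IsCoding a n r)
    (hρ : IsResidue (holePeriod n k) L ρ)
    (hL : (L : ℤ) < holePeriod n (k + 1)) (hh : IsHole n r (k + 1) h) (hj : j = h + 1 + t)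
    (h0 : 0 ≤ t) (h1 : t + ρ < holePeriod n k) (h2 : t + M + ρ < L + holePeriod n k) :
    HasType a n r ω k E M j (.pure t) := by
  have := hρ.add_le hL
  have := hρ.nonneg
  refine ⟨h0, by linarith, ?_, hω.holesAre_of_between hc hh ?_ ?_⟩
  · rw [hj, show h + 1 + t - 1 - t = h by ring]; exact hh.of_succ
  all_goals linarith

/-- Where the arc for the letter `aₖ` is drawn, it can be laid along a factor with `L + ρ + 1` letters
all of whose holes carry `aₖ`. -/
theorem exists_bottom (hω : IsSimpleToeplitzWord a n r ω) (hc : IsCoding a n r)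
    (hρ : IsResidue (holePeriod n k) L ρ) (hL : (L : ℤ) < holePeriod n (k + 1))
    (hb : L + (block a n k).length < (block a n (k + 1)).length ∨ a k ∈ tailAlphabet a (k + 1)) :
    ∃ s, IsHole n r k (s + L) ∧ ∀ x, s ≤ x → x < s + L + ρ + 1 → IsHole n r k x → ω x = a k := by
  have h0 := hρ.nonneg
  have h1 := hρ.lt
  have hP := hc.holePeriod_pos k
  have h2P := hc.two_mul_holePeriod_le k
  obtain ⟨q, hq⟩ := hρ.dvd
  zify at hb
  rw [length_block hc, length_block hc] at hb
  lift ρ to ℕ using h0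
  rcases hb with hb | hb
  · have hh : IsHole n r (k + 1) (holeOffset n r (k + 1)) := isHole_holeOffset
    generalize (holeOffset n r (k + 1) : ℤ) = h at hh
    refine ⟨h + holePeriod n k - ρ, ?_, fun x hx1 hx2 => ?_⟩
    · exact hh.of_succ.iff_dvd.2 ⟨1 + q, by linear_combination hq⟩
    · refine hω.holesAre_of_between hc hh (j := h + holePeriod n k - ρ) (M := L + ρ + 1) ?_ ?_
        x hx1 ?_ <;> push_cast <;> linarith
  · obtain ⟨h, hh, hh'⟩ := hω.exists_apply_eq hc hb
    refine ⟨h - L, by simpa using hh.of_succ, fun x hx1 hx2 => ?_⟩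
    refine hω.holesAre_around hc hh hh' (j := h - L) (M := L + ρ + 1) ?_ ?_
        x hx1 ?_ <;> push_cast <;> linarith

theorem hasType_bottom (hρ : IsResidue (holePeriod n k) L ρ)
    (hs : IsHole n r k (s + L))
    (hs' : ∀ x, s ≤ x → x < s + L + ρ + 1 → IsHole n r k x → ω x = a k)
    (hj : j = s + t) (h0 : 0 ≤ t) (h1 : t ≤ ρ) (h2 : t + M ≤ L + ρ + 1) :
    HasType a n r ω k E M j (.pure (holePeriod n k - 1 - ρ + t)) := by
  have := hρ.lt
  obtain ⟨q, hq⟩ := hρ.dvd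
  refine ⟨by linarith, by linarith, ?_, fun x hx1 hx2 => hs' x (by linarith) (by linarith)⟩
  exact hs.iff_dvd.2 ⟨-q - 1, by rw [hj]; linear_combination -hq⟩

theorem hasType_bottom_tgt (hc : IsCoding a n r) (hρ : IsResidue (holePeriod n k) L ρ)
    (hs : IsHole n r k (s + L))
    (hs' : ∀ x, s ≤ x → x < s + L + ρ + 1 → IsHole n r k x → ω x = a k)
    (hj : j = s + (ρ + 1)) : HasType a n r ω k E L j (.pure 0) := by
  have := hρ.nonneg
  obtain ⟨q, hq⟩ := hρ.dvd
  refine ⟨le_rfl, hc.holePeriod_pos k, ?_, fun x hx1 hx2 => hs' x (by linarith) (by linarith)⟩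
  exact hs.iff_dvd.2 ⟨-q, by rw [hj]; linear_combination -hq⟩

/-- An edge on the arc for the letter `aₖ` occurs only if the figure has this arc. -/
theorem bottom_of_hasType (hω : IsSimpleToeplitzWord a n r ω) (hc : IsCoding a n r)
    (hρ : IsResidue (holePeriod n k) L ρ)
    (hT : HasType a n r ω k E (L + 1) j (.pure φ)) (hφ : holePeriod n k - 1 - ρ ≤ φ) :
    L + (block a n k).length < (block a n (k + 1)).length ∨ a k ∈ tailAlphabet a (k + 1) := by
  obtain ⟨h0, h1, h2, h3⟩ := hT
  have hP := hc.holePeriod_pos k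
  by_contra! hcon
  obtain ⟨hlen, hmem⟩ := hcon
  zify at hlen
  rw [length_block hc, length_block hc] at hlen
  -- the window sees at least `n k` consecutive holes of step `k`, hence one of step `k + 1`
  have h4 : holePeriod n (k + 1) ≤ L - ρ + holePeriod n k := by
    have hd : (holePeriod n k : ℤ) ∣ L - ρ + 2 * holePeriod n k - holePeriod n (k + 1) :=
      dvd_sub (dvd_add hρ.dvd (dvd_mul_left _ _)) holePeriod_dvd_succ
    have := Int.le_of_dvd (by linarith [hρ.lt]) hd
    linarith
  obtain ⟨x, hx, hx1, hx2⟩ := hc.exists_isHole (k + 1) (j - 1 - φ + holePeriod n k)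
  have h5 : x ≤ j - 1 - φ + holePeriod n (k + 1) := by
    have hd : (holePeriod n k : ℤ) ∣
        (j - 1 - φ + holePeriod n k + holePeriod n (k + 1)) - x :=
      (dvd_add (hx.of_succ.iff_dvd'.1 h2 |>.neg_right) (dvd_add dvd_rfl
        (holePeriod_dvd_succ (n := n) (m := k)))).of_eq (by ring)
    have := Int.le_of_dvd (by linarith) hd
    linarith
  refine hmem ?_
  rw [← h3 x (by linarith) (by push_cast; linarith) hx.of_succ]
  exact hω.apply_mem hc hx

theorem hasType_spot (hx : IsHole n r k x) (hxb : ω x = b) (hb : b ≠ a k)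
    (hE : ¬ E ∨ b ≠ a (k - 1)) (hj : j = x - L + t) (h0 : t ≤ L) (h1 : L < t + M) :
    HasType a n r ω k E M j (.spot b (L - t)) := by
  refine ⟨by linarith, by linarith, ?_, ?_, hb, ?_⟩
  · rwa [hj, show x - L + t + (L - t) = x by ring]
  · rwa [hj, show x - L + t + (L - t) = x by ring]
  · rintro ⟨e, hH⟩
    refine hE.elim (fun h => h e) fun h => h ?_
    rw [← hxb]
    exact hH x (by linarith) (by linarith) hx

/-- A stretch of `N` letters whose holes all carry the same letter is a palindrome if its midpoint is a
centre of symmetry of the holes. So reversal flips an arc which is laid along it. -/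
theorem reverse_window_of_holesAre (hω : IsSimpleToeplitzWord a n r ω) (hc : IsCoding a n r)
    {m : ℕ} {N j' : ℤ} (hs : ∀ x, s ≤ x → x < s + N → IsHole n r m x → ω x = c)
    (hd : (holePeriod n m : ℤ) ∣ 2 * s + N - 1 - 2 * holeOffset n r m)
    (hj : j = s + t) (hj' : j' = s + (N - L - t)) (h0 : 0 ≤ t) (h1 : t + L ≤ N) :
    (window ω L j).reverse = window ω L j' := by
  rw [hω.reverse_window hc (m := m) (S := 2 * s + N - 1) hd]
  · congr 1
    rw [hj, hj']; ring
  · intro y hy1 hy2 hy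
    rw [hs y (by linarith) (by linarith) hy, hs _ (by linarith) (by linarith)]
    rw [IsHole] at *
    exact (dvd_sub hd hy).of_eq (by ring)

theorem reverse_window_middle (hω : IsSimpleToeplitzWord a n r ω) (hc : IsCoding a n r)
    {j' : ℤ} (hρ : IsResidue (holePeriod n k) L ρ) (hL : (L : ℤ) < holePeriod n (k + 1))
    (hh : IsHole n r (k + 1) h) (hj : j = h + 1 + t)
    (hj' : j' = h + 1 + (holePeriod n k - 1 - ρ - t)) (h0 : 0 ≤ t) (h1 : t + ρ < holePeriod n k) :
    (window ω L j).reverse = window ω L j' := by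
  have := hρ.add_le hL
  obtain ⟨q, hq⟩ := hρ.dvd
  obtain ⟨p, hp⟩ := hh.of_succ
  refine hω.reverse_window_of_holesAre hc (c := a k) (s := h + 1)
    (N := holePeriod n k - 1 - ρ + L) (fun x hx1 hx2 hx => hω.apply_eq hc hx fun hx' => ?_)
    ⟨2 * p + 1 + q, by linear_combination 2 * hp + hq⟩ hj (by rw [hj']; ring) h0 (by linarith)
  linarith [hx'.eq hh (by linarith) (by linarith)]

theorem reverse_window_bottom (hω : IsSimpleToeplitzWord a n r ω) (hc : IsCoding a n r)
    {j' : ℤ} (hρ : IsResidue (holePeriod n k) L ρ) (hs : IsHole n r k (s + L))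
    (hs' : ∀ x, s ≤ x → x < s + L + ρ + 1 → IsHole n r k x → ω x = a k)
    (hj : j = s + t) (hj' : j' = s + (ρ + 1 - t)) (h0 : 0 ≤ t) (h1 : t ≤ ρ + 1) :
    (window ω L j).reverse = window ω L j' := by
  obtain ⟨q, hq⟩ := hρ.dvd
  obtain ⟨p, hp⟩ := hs
  exact hω.reverse_window_of_holesAre hc (c := a k) (s := s) (N := L + ρ + 1)
    (fun x hx1 hx2 => hs' x hx1 (by linarith)) ⟨2 * p - q, by linear_combination 2 * hp - hq⟩
    hj (by rw [hj']; ring) h0 (by linarith)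

/-- Reversal is the reflection at a hole of step `k + 1`, near this hole. -/
theorem reverse_window_of_isHole (hω : IsSimpleToeplitzWord a n r ω) (hc : IsCoding a n r)
    {j' : ℤ} (hL : (L : ℤ) < holePeriod n (k + 1)) (hh : IsHole n r (k + 1) h)
    (hj : j = h - L + t) (hj' : j' = h + 1 - t) (h0 : 0 ≤ t) (h1 : t ≤ L + 1) :
    (window ω L j).reverse = window ω L j' := by
  have hd : (holePeriod n k : ℤ) ∣ 2 * h - 2 * holeOffset n r k := by
    rw [← mul_sub]; exact Dvd.dvd.mul_left hh.of_succ _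
  rw [hω.reverse_window hc (m := k) (S := 2 * h) hd]
  · congr 1
    rw [hj, hj']; ring
  · intro y hy1 hy2 hy
    have hy' : IsHole n r k (2 * h - y) := by
      rw [IsHole] at *
      exact (dvd_sub hd hy).of_eq (by ring)
    rcases eq_or_ne y h with rfl | hne
    · congr 1; ring
    · rw [hω.apply_eq hc hy, hω.apply_eq hc hy']
      · intro hcon
        exact hne (by linarith [hcon.eq hh (by linarith) (by linarith)])
      · intro hcon
        exact hne (hcon.eq hh (by linarith) (by linarith))

theorem take_block (hω : IsSimpleToeplitzWord a n r ω) (hc : IsCoding a n r)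
    (hL : (L : ℤ) < holePeriod n (k + 1)) (hh : IsHole n r (k + 1) h) :
    (block a n (k + 1)).take L = window ω L (h + 1) := by
  have := length_block hc (k + 1)
  rw [hω.block_eq hc hh, take_window (by omega)]

theorem rtake_block (hω : IsSimpleToeplitzWord a n r ω) (hc : IsCoding a n r)
    (hL : (L : ℤ) < holePeriod n (k + 1)) (hh : IsHole n r (k + 1) h) :
    (block a n (k + 1)).rtake L = window ω L (h - L) := by
  have := length_block hc (k + 1)
  have hh' : IsHole n r (k + 1) (h - holePeriod n (k + 1)) := hh.iff_dvd.2 (by simp)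
  rw [hω.block_eq hc hh', rtake_window (by omega), this]
  congr 1; ring

end IsSimpleToeplitzWord
end Arcs

/-! ### The first and the second figure -/

section Figures

universe u
variable {A : Type u} {a : ℕ → A} {n r : ℕ → ℕ} {ω : ℤ → A} {k L : ℕ}

theorem IsCoding.isResidue_mod (hc : IsCoding a n r) (k L : ℕ) :
    IsResidue (holePeriod n k) L ((L % holePeriod n k : ℕ) : ℤ) := by
  have := hc.holePeriod_pos k
  push_cast
  exact ⟨Int.emod_nonneg _ this.ne', Int.emod_lt_of_pos _ this, Int.dvd_self_sub_emod⟩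

theorem length_block_add_one (hc : IsCoding a n r) (m : ℕ) :
    (block a n m).length + 1 = holePeriod n m := by
  zify; rw [length_block hc]; ring

namespace IsSimpleToeplitzWord

/-- The first figure is the case `k = 0`, in which every position is a hole. -/
theorem depictsSymmetrically₁ [TopologicalSpace A] [DiscreteTopology A]
    (hω : IsSimpleToeplitzWord a n r ω) (hc : IsCoding a n r) (h1L : 1 ≤ L)
    (hL : L ≤ (block a n 1).length) :
    (figure₁ a n L).DepictsSymmetrically (subshiftOf ω) L (nodeWord₁ a n L) := by
  have hP1 : holePeriod n 0 = 1 := by simp [holePeriod]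
  have hρ : IsResidue (holePeriod n 0) L 0 := by
    rw [hP1]; exact ⟨le_rfl, by simp, by simp⟩
  have hL' : (L : ℤ) < holePeriod n (0 + 1) := by
    have := length_block hc 1
    zify at hL
    linarith
  have hh : IsHole n r (0 + 1) (holeOffset n r (0 + 1)) := isHole_holeOffset
  generalize (holeOffset n r (0 + 1) : ℤ) = h at hh
  choose s₀ hs₀ hs₀' using hω.exists_bottom hc hρ hL'
  choose x hx hxb using fun b : (tailAlphabet a 0 \ {a 0} : Set A) =>
    hω.exists_apply_eq hc b.2.1
  have hx' : ∀ b, IsHole n r (0 + 1) (x b) := fun b =>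
    hω.isHole_succ_of_ne hc (hx b) (by rw [hxb]; exact b.2.2)
  have hlen1 : ∀ h, ((figure₁ a n L).len (.loop h) : ℤ) = 0 + 1 := by
    intro h; simp [figure₁]
  have hlen2 : ∀ b, ((figure₁ a n L).len (.arc b) : ℤ) = L + 1 := by
    intro b; simp [figure₁]
  let s : (figure₁ a n L).Arc → ℤ
    | .loop hb => s₀ hb
    | .arc b => x b - L
  let nodeType : (figure₁ a n L).Node → WindowType A := fun _ => .pure 0
  let arcType : (figure₁ a n L).Arc → ℕ → WindowType A
    | .loop _, t => .pure t
    | .arc b, t => .spot b.1 (L - t)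
  have types : ∀ i (t M : ℕ), t + M ≤ (figure₁ a n L).len i + L →
      t < (figure₁ a n L).len i → L < t + M →
      HasType a n r ω 0 False M (s i + t) (arcType i t) := by
    rintro (hb | b) t M h1 h2 h3
    · zify at h1 h2
      rw [hlen1] at h1 h2
      have := hasType_bottom (M := M) (E := False) hρ (hs₀ hb) (hs₀' hb) rfl
        (Nat.cast_nonneg t) (by omega) (by linarith)
      simpa [hP1] using this
    · zify at h1 h2
      rw [hlen2] at h1 h2
      exact hasType_spot (hx b) (hxb b) b.2.2 (Or.inl id) rfl (by omega) (by omega)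
  have suffixType : ∀ h, IsHole n r (0 + 1) h → HasType a n r ω 0 False L (h - L) (.pure 0) := by
    intro h hh
    simpa [hP1] using hω.hasType_suffix (E := False) hc hρ hL' hh rfl
  refine ArcDiagram.Layout.depictsSymmetrically (HT := HasType a n r ω 0 False) (s := s)
    (nodeType := nodeType) (arcType := arcType) ?_
  constructor
  case pos => exact h1L
  case window_eq_iff =>
    intro M h1 h2 j j' κ κ'
    refine hω.window_eq_iff hc (by omega) (by omega) False.elim fun _ j j' _ => ?_
    simp [hP1]
  case exists_hasType => exact hc.exists_hasType ω 0 (L + 1) False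
  case node => exact fun _ => ⟨_, suffixType h hh, hω.rtake_block hc hL' hh⟩
  case endpoint =>
    -- the loop may be missing, but there always is an arc for the letter `a 1 ≠ a 0`
    exact fun _ => ⟨.arc ⟨a 1, ⟨1, by omega, rfl⟩, (hc.ne_succ 0).symm⟩, Or.inl rfl⟩
  case src =>
    rintro (hb | b)
    · have := hasType_bottom (M := L) (E := False) hρ (hs₀ hb) (hs₀' hb) (add_zero _).symm le_rfl
        le_rfl (by linarith)
      simpa [hP1] using this
    · exact suffixType _ (hx' b)
  case tgt =>
    rintro (hb | b)
    · rw [hlen1]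
      exact hasType_bottom_tgt hc hρ (hs₀ hb) (hs₀' hb) rfl
    · rw [hlen2]
      exact hω.hasType_prefix hc hL' (hx' b) (by simp only [s]; ring)
  case interior => exact fun i t h0 h1 => types i t L (by omega) h1 (by omega)
  case edge => exact fun i t h1 => types i t (L + 1) (by omega) h1 (by omega)
  case inj =>
    rintro (hb | b) (hb' | b') t t' ht ht' he <;> zify at ht ht' <;>
      simp only [hlen1, hlen2] at ht ht' <;>
      simp only [arcType, WindowType.pure.injEq, WindowType.spot.injEq, reduceCtorEq] at he
    · exact ⟨rfl, by omega⟩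
    · exact ⟨congrArg _ (Subtype.ext he.1), by omega⟩
  case interior_ne =>
    rintro (hb | b) t _ h0 h1 he <;> zify at h0 h1 <;>
      simp only [hlen1, hlen2] at h1 <;>
      simp only [arcType, nodeType, WindowType.pure.injEq, reduceCtorEq] at he
    omega
  case surj =>
    rintro j (φ | ⟨b, i⟩ | ψ) hT
    · have hT' := hT
      obtain ⟨h0, h1, -, -⟩ := hT
      have hb : L < (block a n 1).length ∨ a 0 ∈ tailAlphabet a 1 :=
        hω.bottom_of_hasType hc hρ hT' (by omega)
      refine ⟨.loop hb, 0, by zify; rw [hlen1]; norm_num, ?_⟩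
      simp only [arcType, WindowType.pure.injEq]; omega
    · obtain ⟨h0, h1, h2, h3, h4, -⟩ := hT
      refine ⟨.arc ⟨b, h3 ▸ hω.apply_mem hc h2, h4⟩, (L - i).toNat, ?_, ?_⟩
      · zify
        rw [hlen2]; omega
      · simp only [arcType, WindowType.spot.injEq, true_and]; omega
    · exact hT.1.elim
  case node_inj => exact fun _ _ _ => rfl
  case axis => exact fun _ _ => Or.inl rfl
  case label =>
    rintro (hb | b) c hlab <;> simp only [figure₁, Option.some.injEq] at hlab
    · rw [← hlab]
      exact hs₀' hb _ (by simp only [s]; linarith) (by simp only [s]; linarith) (hs₀ hb)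
    · rw [← hlab, ← hxb b]
      simp [s]
  case reverse =>
    rintro (hb | b) t ht <;> zify at ht
    · rw [hlen1] at ht ⊢
      exact hω.reverse_window_bottom hc hρ (hs₀ hb) (hs₀' hb) rfl rfl (by positivity) (by linarith)
    · rw [hlen2] at ht ⊢
      exact hω.reverse_window_of_isHole hc hL' (hx' b) rfl
        (by change x b - L + _ = _; ring) (by positivity) (by linarith)

theorem depictsSymmetrically₂ [TopologicalSpace A] [DiscreteTopology A]
    (hω : IsSimpleToeplitzWord a n r ω) (hc : IsCoding a n r) (hk : 1 ≤ k)
    (hkL : (block a n k).length + 1 ≤ L) (hL : L ≤ (block a n (k + 1)).length)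
    (hcase : a (k - 1) ∉ tailAlphabet a k ∨
      2 * (block a n k).length < L + (block a n (k - 1)).length) :
    (figure₂ a n k L).DepictsSymmetrically (subshiftOf ω) L (nodeWord₂ a n k L) := by
  have hρ := hc.isResidue_mod k L
  have hρn := length_block_add_one hc k
  have hB := length_block hc k
  have hPpos := hc.holePeriod_pos k
  have hPL : (holePeriod n k : ℤ) ≤ L := by zify at hkL; linarith
  have hL' : (L : ℤ) < holePeriod n (k + 1) := by
    have := length_block hc (k + 1)
    zify at hL
    linarith
  have hlen0 : ((figure₂ a n k L).len .middle : ℤ)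
      = holePeriod n k - 1 - (L % holePeriod n k : ℕ) := by
    have h2 := hρ.lt
    simp only [figure₂, hρn]
    omega
  have hlen1 : ∀ h, ((figure₂ a n k L).len (.bottom h) : ℤ) = (L % holePeriod n k : ℕ) + 1 := by
    intro h; simp [figure₂, hρn]
  have hlen2 : ∀ b, ((figure₂ a n k L).len (.arc b) : ℤ) = L + 1 := by
    intro b; simp [figure₂]
  generalize ((L % holePeriod n k : ℕ) : ℤ) = ρ at hρ hlen0 hlen1
  have hρ0 := hρ.nonneg
  have hρ1 := hρ.lt
  obtain ⟨q, hq⟩ := hρ.dvd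
  have hh : IsHole n r (k + 1) (holeOffset n r (k + 1)) := isHole_holeOffset
  generalize (holeOffset n r (k + 1) : ℤ) = h at hh
  choose s₀ hs₀ hs₀' using hω.exists_bottom hc hρ hL'
  choose x hx hxb using fun b : (tailAlphabet a k \ {a k} : Set A) =>
    hω.exists_apply_eq hc b.2.1
  have hx' : ∀ b, IsHole n r (k + 1) (x b) := fun b =>
    hω.isHole_succ_of_ne hc (hx b) (by rw [hxb]; exact b.2.2)
  -- The middle path follows a block `p^{(k)}`; the arc for `b` follows `ω` across the hole `x b`,
  -- which carries `b`, from the block that ends there to the block that starts there.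
  let s : (figure₂ a n k L).Arc → ℤ
    | .middle => h + 1
    | .bottom hb => s₀ hb
    | .arc b => x b - L
  let nodeType : (figure₂ a n k L).Node → WindowType A
    | .u₁ => .pure 0
    | .v₁ => .pure (holePeriod n k - 1 - ρ)
  let arcType : (figure₂ a n k L).Arc → ℕ → WindowType A
    | .middle, t => .pure t
    | .bottom _, t => .pure (holePeriod n k - 1 - ρ + t)
    | .arc b, t => .spot b.1 (L - t)
  have types : ∀ i (t M : ℕ), t + M ≤ (figure₂ a n k L).len i + L →
      t < (figure₂ a n k L).len i → L < t + M →
      HasType a n r ω k False M (s i + t) (arcType i t) := by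
    rintro (_ | hb | b) t M h1 h2 h3
    · zify at h1 h2
      rw [hlen0] at h1 h2
      exact hω.hasType_middle hc hρ hL' hh rfl (by positivity) (by linarith) (by linarith)
    · zify at h1 h2
      rw [hlen1] at h1 h2
      exact hasType_bottom hρ (hs₀ hb) (hs₀' hb) rfl (by positivity) (by omega) (by linarith)
    · zify at h1 h2
      rw [hlen2] at h1 h2
      exact hasType_spot (hx b) (hxb b) b.2.2 (Or.inl id) rfl (by omega) (by omega)
  refine ArcDiagram.Layout.depictsSymmetrically (HT := HasType a n r ω k False) (s := s)
    (nodeType := nodeType) (arcType := arcType) ?_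
  constructor
  case pos => omega
  case window_eq_iff =>
    intro M h1 h2 j j' κ κ'
    refine hω.window_eq_iff hc (by omega) (by omega) False.elim fun _ j j' he => ?_
    obtain ⟨m, rfl⟩ := Nat.exists_eq_add_of_le' hk
    -- the hypothesis of this figure excludes the exceptional case of recognizability
    rcases hω.dvd_sub_or_holesAre (m := m) hc (by omega) he with h3 | ⟨-, -, -, h3, h4⟩
    · exact h3
    · have := length_block hc m
      rw [Nat.add_sub_cancel] at hcase
      exact hcase.elim (fun h => absurd h3 h) fun h => by omega
  case exists_hasType => exact hc.exists_hasType ω k (L + 1) False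
  case node =>
    rintro (_ | _)
    · exact ⟨_, hω.hasType_prefix hc hL' hh rfl, hω.take_block hc hL' hh⟩
    · exact ⟨_, hω.hasType_suffix hc hρ hL' hh rfl, hω.rtake_block hc hL' hh⟩
  case endpoint =>
    rintro (_ | _)
    · exact ⟨.middle, Or.inl rfl⟩
    · exact ⟨.middle, Or.inr rfl⟩
  case src =>
    rintro (_ | hb | b)
    · exact hω.hasType_prefix hc hL' hh rfl
    · have := hasType_bottom (M := L) (E := False) hρ (hs₀ hb) (hs₀' hb) (add_zero _).symm le_rfl
        hρ0 (by linarith)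
      rwa [add_zero] at this
    · exact hω.hasType_suffix hc hρ hL' (hx' b) rfl
  case tgt =>
    rintro (_ | hb | b)
    · rw [hlen0]
      refine hω.hasType_middle hc hρ hL' hh rfl ?_ ?_ ?_ <;> linarith
    · rw [hlen1]
      exact hasType_bottom_tgt hc hρ (hs₀ hb) (hs₀' hb) rfl
    · rw [hlen2]
      exact hω.hasType_prefix hc hL' (hx' b) (by simp only [s]; ring)
  case interior => exact fun i t h0 h1 => types i t L (by omega) h1 (by omega)
  case edge => exact fun i t h1 => types i t (L + 1) (by omega) h1 (by omega)
  case inj =>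
    rintro (_ | hb | b) (_ | hb' | b') t t' ht ht' he <;> zify at ht ht' <;>
      simp only [hlen0, hlen1, hlen2] at ht ht' <;>
      simp only [arcType, WindowType.pure.injEq, WindowType.spot.injEq, reduceCtorEq] at he
    · exact ⟨rfl, by omega⟩
    · omega
    · omega
    · exact ⟨rfl, by omega⟩
    · exact ⟨congrArg _ (Subtype.ext he.1), by omega⟩
  case interior_ne =>
    rintro (_ | hb | b) t (_ | _) h0 h1 he <;> zify at h0 h1 <;>
      simp only [hlen0, hlen1, hlen2] at h1 <;>
      simp only [arcType, nodeType, WindowType.pure.injEq, reduceCtorEq] at he <;> omega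
  case surj =>
    rintro j (φ | ⟨b, i⟩ | ψ) hT
    · have hT' := hT
      obtain ⟨h0, h1, -, -⟩ := hT
      lift φ to ℕ using h0
      by_cases hφ : (φ : ℤ) < holePeriod n k - 1 - ρ
      · exact ⟨.middle, φ, by zify; rw [hlen0]; exact hφ, rfl⟩
      · have hb := hω.bottom_of_hasType hc hρ hT' (by linarith)
        refine ⟨.bottom hb, (φ - (holePeriod n k - 1 - ρ)).toNat, ?_, ?_⟩
        · zify
          rw [hlen1]; omega
        · simp only [arcType, WindowType.pure.injEq]; omega
    · obtain ⟨h0, h1, h2, h3, h4, -⟩ := hT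
      refine ⟨.arc ⟨b, h3 ▸ hω.apply_mem hc h2, h4⟩, (L - i).toNat, ?_, ?_⟩
      · zify
        rw [hlen2]; omega
      · simp only [arcType, WindowType.spot.injEq, true_and]; omega
    · exact hT.1.elim
  case node_inj =>
    have hm : (holePeriod n k : ℤ) - 1 - ρ = 0 → (figure₂ a n k L).node .u₁
        = (figure₂ a n k L).node .v₁ := fun h =>
      (figure₂ a n k L).node_src_eq_node_tgt (i := .middle) (by zify; rw [hlen0, h])
    rintro (_ | _) (_ | _) he <;> simp only [nodeType, WindowType.pure.injEq] at he
    · rfl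
    · exact hm he.symm
    · exact (hm he).symm
    · rfl
  case axis =>
    rintro (_ | _) he <;> simp only [nodeType, figure₂, Node₂.mirror, WindowType.pure.injEq] at he
    · exact Or.inr ⟨.middle, rfl, by zify; rw [hlen0, he], Or.inl rfl⟩
    · exact Or.inr ⟨.middle, rfl, by zify; rw [hlen0, ← he], Or.inr rfl⟩
  case label =>
    rintro (_ | hb | b) c hlab <;> simp only [figure₂, reduceCtorEq, Option.some.injEq] at hlab
    · rw [← hlab]
      exact hs₀' hb _ (by simp only [s]; linarith) (by simp only [s]; linarith) (hs₀ hb)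
    · rw [← hlab, ← hxb b]
      simp [s]
  case reverse =>
    rintro (_ | hb | b) t ht <;> zify at ht
    · rw [hlen0] at ht ⊢
      exact hω.reverse_window_middle hc hρ hL' hh rfl rfl (by positivity) (by linarith)
    · rw [hlen1] at ht ⊢
      exact hω.reverse_window_bottom hc hρ (hs₀ hb) (hs₀' hb) rfl rfl (by positivity) (by linarith)
    · rw [hlen2] at ht ⊢
      exact hω.reverse_window_of_isHole hc hL' (hx' b) rfl
        (by change x b - L + _ = _; ring) (by positivity) (by linarith)

end IsSimpleToeplitzWord
end Figures

/-! ### The third figure -/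

section Exceptional

universe u
variable {A : Type u} {a : ℕ → A} {n r : ℕ → ℕ} {ω : ℤ → A} {k L M : ℕ} {h j t ρ : ℤ} {E : Prop}

namespace IsSimpleToeplitzWord

theorem _root_.ToeplitzRauzy.IsHole.holesAre_inner (hh : IsHole n r k h) (hd : ω h = a (k - 1))
    (h1 : h - holePeriod n k < j) (h2 : j + M ≤ h + holePeriod n k) :
    HolesAre n r ω k (a (k - 1)) M j := by
  intro x hx1 hx2 hx
  rw [hx.eq hh (by linarith) (by linarith), hd]

/-- The letter `aₖ₋₁` at a hole of a factor that sees the hole to the left or to the right as well. -/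
theorem hasType_spot_pred (hω : IsSimpleToeplitzWord a n r ω) (hc : IsCoding a n r)
    (hk : 1 ≤ k) (hh : IsHole n r k h) (hd : ω h = a (k - 1))
    (hj : j = h - L + t) (h0 : t ≤ L) (h1 : L < t + M)
    (hM : L - t ≥ holePeriod n k ∨ t + M > L + holePeriod n k) :
    HasType a n r ω k E M j (.spot (a (k - 1)) (L - t)) := by
  have hP := hc.holePeriod_pos k
  have h2P := hc.two_mul_holePeriod_le k
  have hne : a (k - 1) ≠ a k := by
    have := hc.ne_succ (k - 1)
    rwa [Nat.sub_add_cancel hk] at this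
  have hh' := hω.isHole_succ_of_ne hc hh (hd ▸ hne)
  refine ⟨by linarith, by linarith, ?_, ?_, hne, ?_⟩
  · rwa [hj, show h - L + t + (L - t) = h by ring]
  · rwa [hj, show h - L + t + (L - t) = h by ring]
  · rintro ⟨-, hH⟩
    have key : ∀ x, j ≤ x → x < j + M → x = h - holePeriod n k ∨ x = h + holePeriod n k → False := by
      intro x h1 h2 h3
      have hx : IsHole n r k x := by
        rcases h3 with rfl | rfl <;> exact hh.iff_dvd.2 (by simp)
      have h4 := hω.apply_eq hc hx fun hx' => by
        have := hx'.eq hh' (by rcases h3 with rfl | rfl <;> linarith)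
          (by rcases h3 with rfl | rfl <;> linarith)
        rcases h3 with rfl | rfl <;> linarith
      exact hne ((hH x h1 h2 hx).symm.trans h4)
    rcases hM with hM | hM
    · exact key (h - holePeriod n k) (by linarith) (by linarith) (Or.inl rfl)
    · exact key (h + holePeriod n k) (by linarith) (by linarith) (Or.inr rfl)

set_option maxHeartbeats 1000000 in
theorem depictsSymmetrically₃ [TopologicalSpace A] [DiscreteTopology A]
    (hω : IsSimpleToeplitzWord a n r ω) (hc : IsCoding a n r) (hk : 1 ≤ k)
    (hkL : (block a n k).length + 1 ≤ L) (hL : L ≤ (block a n (k + 1)).length)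
    (hmem : a (k - 1) ∈ tailAlphabet a k)
    (hcase : L + (block a n (k - 1)).length ≤ 2 * (block a n k).length) :
    (figure₃ a n k L).DepictsSymmetrically (subshiftOf ω) L (nodeWord₃ a n k L) := by
  have hρ := hc.isResidue_mod k L
  have hρ' := hc.isResidue_mod (k - 1) L
  have hρn := length_block_add_one hc k
  have hρn' := length_block_add_one hc (k - 1)
  have hB := length_block hc k
  have hB' := length_block hc (k - 1)
  have hPpos := hc.holePeriod_pos k
  have hQpos := hc.holePeriod_pos (k - 1)
  have hPL : (holePeriod n k : ℤ) ≤ L := by zify at hkL; linarith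
  have hL' : (L : ℤ) < holePeriod n (k + 1) := by
    have := length_block hc (k + 1)
    zify at hL
    linarith
  have hLQ : (L : ℤ) + holePeriod n (k - 1) < 2 * holePeriod n k := by
    zify at hcase; linarith
  have hlen0 : ((figure₃ a n k L).len .middle : ℤ)
      = holePeriod n k - 1 - (L % holePeriod n k : ℕ) := by
    have h2 := hρ.lt
    simp only [figure₃, hρn]
    omega
  have hlen1 : ∀ h, ((figure₃ a n k L).len (.bottom h) : ℤ) = (L % holePeriod n k : ℕ) + 1 := by
    intro h; simp [figure₃, hρn]
  have hlen2 : ∀ b, ((figure₃ a n k L).len (.arc b) : ℤ) = L + 1 := by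
    intro b; simp [figure₃]
  have hlen3 : ((figure₃ a n k L).len .right : ℤ) = (L % holePeriod n k : ℕ) + 1 := by
    simp [figure₃, hρn]
  have hlen4 : ((figure₃ a n k L).len .left : ℤ) = (L % holePeriod n k : ℕ) + 1 := by
    simp [figure₃, hρn]
  have hlen5 : ((figure₃ a n k L).len .innerTop : ℤ)
      = holePeriod n (k - 1) - 1 - (L % holePeriod n (k - 1) : ℕ) := by
    have h2 := hρ'.lt
    simp only [figure₃, hρn']
    omega
  have hlen6 : ((figure₃ a n k L).len .innerBottom : ℤ) = (L % holePeriod n (k - 1) : ℕ) + 1 := by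
    simp [figure₃, hρn']
  generalize ((L % holePeriod n k : ℕ) : ℤ) = ρ at hρ hlen0 hlen1 hlen3 hlen4
  generalize ((L % holePeriod n (k - 1) : ℕ) : ℤ) = ρ' at hρ' hlen5 hlen6
  have hρ0 := hρ.nonneg
  have hρ1 := hρ.lt
  have hρ0' := hρ'.nonneg
  have hρ1' := hρ'.lt
  -- `L` exceeds `|p^{(k-1)}| + 1`, but not its double
  have hρL : ρ = L - holePeriod n k := by
    have := Int.eq_zero_of_abs_lt_dvd (dvd_sub hρ.dvd dvd_rfl)
      (by rw [abs_lt]; constructor <;> linarith)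
    linarith
  obtain ⟨q', hq'⟩ := hρ'.dvd
  have hdk : a (k - 1) ≠ a k := by
    have := hc.ne_succ (k - 1)
    rwa [Nat.sub_add_cancel hk] at this
  have hh : IsHole n r (k + 1) (holeOffset n r (k + 1)) := isHole_holeOffset
  generalize (holeOffset n r (k + 1) : ℤ) = h at hh
  choose s₀ hs₀ hs₀' using hω.exists_bottom hc hρ hL'
  choose x hx hxb using fun b : (tailAlphabet a k \ {a (k - 1), a k} : Set A) =>
    hω.exists_apply_eq hc b.2.1
  have hbk : ∀ b : (tailAlphabet a k \ {a (k - 1), a k} : Set A), b.1 ≠ a (k - 1) ∧ b.1 ≠ a k := by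
    intro b
    simpa using b.2.2
  have hx' : ∀ b, IsHole n r (k + 1) (x b) := fun b =>
    hω.isHole_succ_of_ne hc (hx b) (by rw [hxb]; exact (hbk b).2)
  obtain ⟨g, hg, hgd⟩ := hω.exists_apply_eq hc hmem
  have hg' := hω.isHole_succ_of_ne hc hg (hgd ▸ hdk)
  have hgQ : ∀ {y : ℤ}, (holePeriod n (k - 1) : ℤ) ∣ y - g → IsHole n r (k - 1) y := by
    intro y hy
    have : IsHole n r (k - 1) g := by
      obtain ⟨m, rfl⟩ := Nat.exists_eq_add_of_le' hk
      exact hg.of_succ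
    exact this.iff_dvd.2 hy
  have hQP : (holePeriod n (k - 1) : ℤ) ∣ holePeriod n k := by
    obtain ⟨m, rfl⟩ := Nat.exists_eq_add_of_le' hk
    exact holePeriod_dvd_succ
  have hinner : ∀ y, g - holePeriod n k < y → y < g + holePeriod n k →
      IsHole n r (k - 1) y → ω y = a (k - 1) := by
    intro y hy1 hy2 hy
    obtain ⟨m, rfl⟩ := Nat.exists_eq_add_of_le' hk
    refine hω.holesAre_of_holesAre_succ hc (M := 1) (hg.holesAre_inner hgd hy1 ?_) y le_rfl ?_ hy
    · push_cast; linarith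
    · push_cast; linarith
  obtain ⟨p, hp⟩ := hQP
  have hinnerType : ∀ {M : ℕ} {j ψ : ℤ}, 0 ≤ ψ → ψ < holePeriod n (k - 1) →
      (holePeriod n (k - 1) : ℤ) ∣ j - 1 - ψ - g → g - holePeriod n k < j →
      j + M ≤ g + holePeriod n k → HasType a n r ω k True M j (.inner ψ) :=
    fun h0 h1 h2 h3 h4 => ⟨trivial, h0, h1, hgQ h2, hg.holesAre_inner hgd h3 h4⟩
  -- The arcs `right`, `innerTop`, `innerBottom`, `left` follow `ω` around the hole `g`, which carries
  -- the letter `a (k - 1)`; the inner arcs close up since the blocks around `g` have the smaller period.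
  let s : (figure₃ a n k L).Arc → ℤ
    | .middle => h + 1
    | .bottom hb => s₀ hb
    | .arc b => x b - L
    | .right => g - L
    | .left => g - ρ
    | .innerTop => g - holePeriod n k + 1
    | .innerBottom => g - holePeriod n k + holePeriod n (k - 1) - ρ'
  let nodeType : (figure₃ a n k L).Node → WindowType A
    | .u₁ => .pure 0
    | .v₁ => .pure (holePeriod n k - 1 - ρ)
    | .u₂ => .inner 0
    | .v₂ => .inner (holePeriod n (k - 1) - 1 - ρ')
  let arcType : (figure₃ a n k L).Arc → ℕ → WindowType A
    | .middle, t => .pure t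
    | .bottom _, t => .pure (holePeriod n k - 1 - ρ + t)
    | .arc b, t => .spot b.1 (L - t)
    | .right, t => .spot (a (k - 1)) (L - t)
    | .left, t => .spot (a (k - 1)) (ρ - t)
    | .innerTop, t => .inner t
    | .innerBottom, t => .inner (holePeriod n (k - 1) - 1 - ρ' + t)
  have types : ∀ i (t M : ℕ), t + M ≤ (figure₃ a n k L).len i + L →
      t < (figure₃ a n k L).len i → L < t + M →
      HasType a n r ω k True M (s i + t) (arcType i t) := by
    rintro (_ | hb | b | _ | _ | _ | _) t M h1 h2 h3 <;> zify at h1 h2 h3 <;>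
      simp only [hlen0, hlen1, hlen2, hlen3, hlen4, hlen5, hlen6] at h1 h2 <;>
      have ht := Int.natCast_nonneg t
    · exact hω.hasType_middle hc hρ hL' hh rfl (by positivity) (by linarith) (by linarith)
    · exact hasType_bottom hρ (hs₀ hb) (hs₀' hb) rfl (by positivity) (by omega) (by linarith)
    · exact hasType_spot (hx b) (hxb b) (hbk b).2 (Or.inr (hbk b).1) rfl (by omega) (by omega)
    · exact hω.hasType_spot_pred hc hk hg hgd rfl (by omega) (by omega) (Or.inl (by omega))
    · have := hω.hasType_spot_pred (E := True) (L := L) (M := M) (t := t + holePeriod n k)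
        hc hk hg hgd rfl (by omega) (by omega) (Or.inr (by omega))
      convert this using 1
      · simp only [s]; linarith
      · simp only [arcType, WindowType.spot.injEq, true_and]; linarith
    · exact hinnerType ht (by omega) ⟨-p, by simp only [s]; linear_combination -hp⟩
        (by simp only [s]; linarith) (by simp only [s]; linarith)
    · exact hinnerType (by omega) (by omega) ⟨-p, by simp only [s]; linear_combination -hp⟩
        (by simp only [s]; linarith) (by simp only [s]; linarith)
  have hu₂ : HasType a n r ω k True L (g - holePeriod n k + 1) (.inner 0) :=
    hinnerType le_rfl hQpos ⟨-p, by linear_combination -hp⟩ (by linarith) (by linarith)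
  have hv₂ : HasType a n r ω k True L (g + holePeriod n k - L)
      (.inner (holePeriod n (k - 1) - 1 - ρ')) :=
    hinnerType (by linarith) (by linarith) ⟨p - 1 - q', by linear_combination hp - hq'⟩
      (by linarith) (by linarith)
  have hword : block a n k ++ a (k - 1) :: block a n k
      = window ω (2 * (block a n k).length + 1) (g - holePeriod n k + 1) := by
    have hg2 : IsHole n r k (g - holePeriod n k) := hg.iff_dvd.2 (by simp)
    rw [two_mul, add_assoc, window_add, ← hω.block_eq hc hg2, window_succ',
      hB, show g - holePeriod n k + 1 + (holePeriod n k - 1 : ℤ) = g by ring, hgd,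
      ← hω.block_eq hc hg]
  refine ArcDiagram.Layout.depictsSymmetrically (HT := HasType a n r ω k True) (s := s)
    (nodeType := nodeType) (arcType := arcType) ?_
  constructor
  case pos => omega
  case window_eq_iff =>
    intro M h1 h2 j j' κ κ'
    exact hω.window_eq_iff hc (by omega) (by omega) (fun _ => hk) fun h => absurd trivial h
  case exists_hasType => exact hc.exists_hasType ω k (L + 1) True
  case node =>
    rintro (_ | _ | _ | _)
    · exact ⟨_, hω.hasType_prefix hc hL' hh rfl, hω.take_block hc hL' hh⟩
    · exact ⟨_, hω.hasType_suffix hc hρ hL' hh rfl, hω.rtake_block hc hL' hh⟩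
    · refine ⟨_, hu₂, ?_⟩
      rw [nodeWord₃, hword, take_window (by omega)]
    · refine ⟨_, hv₂, ?_⟩
      rw [nodeWord₃, hword, rtake_window (by omega)]
      congr 1
      push_cast; rw [hB]; ring
  case endpoint =>
    rintro (_ | _ | _ | _)
    · exact ⟨.middle, Or.inl rfl⟩
    · exact ⟨.middle, Or.inr rfl⟩
    · exact ⟨.innerTop, Or.inl rfl⟩
    · exact ⟨.innerTop, Or.inr rfl⟩
  case src =>
    rintro (_ | hb | b | _ | _ | _ | _)
    · exact hω.hasType_prefix hc hL' hh rfl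
    · have := hasType_bottom (M := L) (E := True) hρ (hs₀ hb) (hs₀' hb) (add_zero _).symm le_rfl
        hρ0 (by linarith)
      rwa [add_zero] at this
    · exact hω.hasType_suffix hc hρ hL' (hx' b) rfl
    · exact hω.hasType_suffix hc hρ hL' hg' rfl
    · exact hinnerType (by linarith) (by linarith)
        ⟨p - 1 - q', by simp only [s]; linear_combination hp - hq' - hρL⟩
        (by simp only [s]; linarith) (by simp only [s]; linarith)
    · exact hu₂
    · exact hinnerType (by linarith) (by linarith) ⟨-p, by simp only [s]; linear_combination -hp⟩
        (by simp only [s]; linarith) (by simp only [s]; linarith)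
  case tgt =>
    rintro (_ | hb | b | _ | _ | _ | _)
    · rw [hlen0]
      refine hω.hasType_middle hc hρ hL' hh rfl ?_ ?_ ?_ <;> linarith
    · rw [hlen1]
      exact hasType_bottom_tgt hc hρ (hs₀ hb) (hs₀' hb) rfl
    · rw [hlen2]
      exact hω.hasType_prefix hc hL' (hx' b) (by simp only [s]; ring)
    · rw [hlen3]
      exact hinnerType le_rfl hQpos ⟨-p, by simp only [s]; linear_combination -hp + hρL⟩
        (by simp only [s]; linarith) (by simp only [s]; linarith)
    · rw [hlen4]
      exact hω.hasType_prefix hc hL' hg' (by simp only [s]; ring)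
    · rw [hlen5]
      exact hinnerType (by linarith) (by linarith) ⟨-p, by simp only [s]; linear_combination -hp⟩
        (by simp only [s]; linarith) (by simp only [s]; linarith)
    · rw [hlen6]
      exact hinnerType le_rfl hQpos ⟨1 - p, by simp only [s]; linear_combination -hp⟩
        (by simp only [s]; linarith) (by simp only [s]; linarith)
  case interior => exact fun i t h0 h1 => types i t L (by omega) h1 (by omega)
  case edge => exact fun i t h1 => types i t (L + 1) (by omega) h1 (by omega)
  case inj =>
    rintro (_ | hb | b | _ | _ | _ | _) (_ | hb' | b' | _ | _ | _ | _) t t' ht ht' he <;>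
      zify at ht ht' <;>
      simp only [hlen0, hlen1, hlen2, hlen3, hlen4, hlen5, hlen6] at ht ht' <;>
      simp only [arcType, WindowType.pure.injEq, WindowType.spot.injEq, WindowType.inner.injEq,
        reduceCtorEq, true_and] at he
    all_goals first
      | exact ⟨rfl, by omega⟩
      | omega
      | exact absurd he.1 (hbk b).1
      | exact absurd he.1.symm (hbk b').1
      | exact ⟨congrArg _ (Subtype.ext he.1), by omega⟩
  case interior_ne =>
    rintro (_ | hb | b | _ | _ | _ | _) t (_ | _ | _ | _) h0 h1 he <;> zify at h0 h1 <;>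
      simp only [hlen0, hlen1, hlen2, hlen3, hlen4, hlen5, hlen6] at h1 <;>
      simp only [arcType, nodeType, WindowType.pure.injEq, WindowType.inner.injEq,
        reduceCtorEq] at he <;> omega
  case surj =>
    rintro j (φ | ⟨b, i⟩ | ψ) hT
    · have hT' := hT
      obtain ⟨h0, h1, -, -⟩ := hT
      lift φ to ℕ using h0
      by_cases hφ : (φ : ℤ) < holePeriod n k - 1 - ρ
      · exact ⟨.middle, φ, by zify; rw [hlen0]; exact hφ, rfl⟩
      · have hb := hω.bottom_of_hasType hc hρ hT' (by linarith)
        refine ⟨.bottom hb, (φ - (holePeriod n k - 1 - ρ)).toNat, ?_, ?_⟩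
        · zify
          rw [hlen1]; omega
        · simp only [arcType, WindowType.pure.injEq]; omega
    · obtain ⟨h0, h1, h2, h3, h4, h5⟩ := hT
      by_cases hb : b = a (k - 1)
      · subst hb
        rcases lt_or_ge ρ i with hi | hi
        · have hi' : (holePeriod n k : ℤ) ≤ i := by
            by_contra hlt
            refine h5 ⟨trivial, h2.holesAre_inner h3 (by linarith) ?_⟩
            push_cast; linarith
          refine ⟨.right, (L - i).toNat, ?_, ?_⟩
          · zify
            rw [hlen3]; omega
          · simp only [arcType, WindowType.spot.injEq, true_and]; omega
        · refine ⟨.left, (ρ - i).toNat, ?_, ?_⟩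
          · zify
            rw [hlen4]; omega
          · simp only [arcType, WindowType.spot.injEq, true_and]; omega
      · refine ⟨.arc ⟨b, h3 ▸ hω.apply_mem hc h2, by simp [hb, h4]⟩, (L - i).toNat, ?_, ?_⟩
        · zify
          rw [hlen2]; omega
        · simp only [arcType, WindowType.spot.injEq, true_and]; omega
    · obtain ⟨-, h0, h1, -, -⟩ := hT
      lift ψ to ℕ using h0
      by_cases hψ : (ψ : ℤ) < holePeriod n (k - 1) - 1 - ρ'
      · exact ⟨.innerTop, ψ, by zify; rw [hlen5]; exact hψ, rfl⟩
      · refine ⟨.innerBottom, (ψ - (holePeriod n (k - 1) - 1 - ρ')).toNat, ?_, ?_⟩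
        · zify
          rw [hlen6]; omega
        · simp only [arcType, WindowType.inner.injEq]; omega
  case node_inj =>
    have hm : (holePeriod n k : ℤ) - 1 - ρ = 0 → (figure₃ a n k L).node .u₁
        = (figure₃ a n k L).node .v₁ := fun h =>
      (figure₃ a n k L).node_src_eq_node_tgt (i := .middle) (by zify; rw [hlen0, h])
    have hm' : (holePeriod n (k - 1) : ℤ) - 1 - ρ' = 0 → (figure₃ a n k L).node .u₂
        = (figure₃ a n k L).node .v₂ := fun h =>
      (figure₃ a n k L).node_src_eq_node_tgt (i := .innerTop) (by zify; rw [hlen5, h])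
    rintro (_ | _ | _ | _) (_ | _ | _ | _) he <;>
      simp only [nodeType, WindowType.pure.injEq, WindowType.inner.injEq, reduceCtorEq] at he
    · rfl
    · exact hm he.symm
    · exact (hm he).symm
    · rfl
    · rfl
    · exact hm' he.symm
    · exact (hm' he).symm
    · rfl
  case axis =>
    rintro (_ | _ | _ | _) he <;>
      simp only [nodeType, figure₃, Node₃.mirror, WindowType.pure.injEq,
        WindowType.inner.injEq] at he
    · exact Or.inr ⟨.middle, rfl, by zify; rw [hlen0, he], Or.inl rfl⟩
    · exact Or.inr ⟨.middle, rfl, by zify; rw [hlen0, ← he], Or.inr rfl⟩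
    · exact Or.inr ⟨.innerTop, rfl, by zify; rw [hlen5, he], Or.inl rfl⟩
    · exact Or.inr ⟨.innerTop, rfl, by zify; rw [hlen5, ← he], Or.inr rfl⟩
  case label =>
    rintro (_ | hb | b | _ | _ | _ | _) c hlab <;>
      simp only [figure₃, reduceCtorEq, Option.some.injEq] at hlab <;> rw [← hlab]
    · exact hs₀' hb _ (by simp only [s]; linarith) (by simp only [s]; linarith) (hs₀ hb)
    · rw [← hxb b]
      simp [s]
    · have e : s .right + L = g := by simp only [s]; ring
      exact (congrArg ω e).trans hgd
    · have hgP : IsHole n r k (g + holePeriod n k) := hg.iff_dvd.2 (by simp)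
      have e : s .left + L = g + holePeriod n k := by simp only [s]; linarith
      refine (congrArg ω e).trans (hω.apply_eq hc hgP fun hcon => ?_)
      have := hcon.eq hg' (by linarith [hc.two_mul_holePeriod_le k]) (by linarith)
      linarith
    · exact hinner _ (by simp only [s]; linarith) (by simp only [s]; linarith)
        (hgQ ⟨1 + q' - p, by simp only [s]; linear_combination hq' - hp⟩)
  case reverse =>
    have hgo : (holePeriod n (k - 1) : ℤ) ∣ g - holeOffset n r (k - 1) := hgQ (by simp)
    obtain ⟨o, ho⟩ := hgo
    rintro (_ | hb | b | _ | _ | _ | _) t ht <;> zify at ht <;>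
      simp only [hlen0, hlen1, hlen2, hlen3, hlen4, hlen5, hlen6] at ht ⊢ <;>
      have ht0 := Int.natCast_nonneg t
    · exact hω.reverse_window_middle hc hρ hL' hh rfl rfl (by positivity) (by linarith)
    · exact hω.reverse_window_bottom hc hρ (hs₀ hb) (hs₀' hb) rfl rfl (by positivity) (by linarith)
    · exact hω.reverse_window_of_isHole hc hL' (hx' b) rfl
        (by change x b - L + _ = _; ring) (by positivity) (by linarith)
    · exact hω.reverse_window_of_isHole hc hL' hg' rfl
        (by change g - ρ + _ = _; ring) (by positivity) (by linarith)
    · exact hω.reverse_window_of_isHole hc hL' hg' (t := t + holePeriod n k)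
        (by simp only [s]; linarith) (by change g - L + _ = _; linarith) (by positivity)
        (by linarith)
    · exact hω.reverse_window_of_holesAre hc (N := holePeriod n (k - 1) - 1 - ρ' + L)
        (fun y hy1 hy2 => hinner y (by linarith) (by linarith))
        ⟨2 * o - 2 * p + 1 + q', by linear_combination 2 * ho - 2 * hp + hq'⟩ rfl
        (by change g - holePeriod n k + 1 + _ = _; ring) ht0 (by linarith)
    · exact hω.reverse_window_of_holesAre hc (N := ρ' + 1 + L)
        (fun y hy1 hy2 => hinner y (by linarith) (by linarith))
        ⟨2 * o - 2 * p + 2 + q', by linear_combination 2 * ho - 2 * hp + hq'⟩ rfl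
        (by change g - holePeriod n k + holePeriod n (k - 1) - ρ' + _ = _; ring) ht0 (by linarith)

end IsSimpleToeplitzWord
end Exceptional
end ToeplitzRauzy

theorem mainTheorem5 {A : Type*} [Finite A] [TopologicalSpace A] [DiscreteTopology A]
    (a : ℕ → A) (n r : ℕ → ℕ) (hc : IsCoding a n r)
    (ω : ℤ → A) (hω : IsSimpleToeplitzWord a n r ω) :
    (∀ L : ℕ, 1 ≤ L → L ≤ (block a n 1).length →
      (figure₁ a n L).DepictsSymmetrically (subshiftOf ω) L (nodeWord₁ a n L)) ∧
    (∀ k L : ℕ, 1 ≤ k → (block a n k).length + 1 ≤ L → L ≤ (block a n (k + 1)).length →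
      ((a (k - 1) ∉ tailAlphabet a k ∨
          2 * (block a n k).length < L + (block a n (k - 1)).length) →
        (figure₂ a n k L).DepictsSymmetrically (subshiftOf ω) L (nodeWord₂ a n k L)) ∧
      ((a (k - 1) ∈ tailAlphabet a k ∧
          L + (block a n (k - 1)).length ≤ 2 * (block a n k).length) →
        (figure₃ a n k L).DepictsSymmetrically (subshiftOf ω) L (nodeWord₃ a n k L))) := by
  refine ⟨fun L h1 h2 => hω.depictsSymmetrically₁ hc h1 h2, fun k L hk h1 h2 => ⟨fun h => ?_, ?_⟩⟩
  · exact hω.depictsSymmetrically₂ hc hk h1 h2 h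
  · rintro ⟨h3, h4⟩
    exact hω.depictsSymmetrically₃ hc hk h1 h2 h3 h4
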